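/- Let $A$ be a closed, densely defined symmetric operator with finite equal deficiency indices in a complex Hilbert space $\mathcal H$. Let $\mathcal H_+=D(A^*)$ with inner product $(f,g)_+=(f,g)+(A^*f,A^*g)$, let $\mathcal H_-$ be the space of bounded conjugate-linear functionals on $\mathcal H_+$, so that $\mathcal H_+\subset\mathcal H\subset\mathcal H_-$, and write $[X,Y]$ for the bounded linear operators from $X$ to $Y$. For $\mathbb B\in[\mathcal H_+,\mathcal H_-]$ the adjoint $\mathbb B^*\in[\mathcal H_+,\mathcal H_-]$ is given by $(\mathbb B^*f,g)=(f,\mathbb Bg)$, and $\mathrm{Re}\,\mathbb B=\frac12(\mathbb B+\mathbb B^*)$, $\mathrm{Im}\,\mathbb B=\frac1{2i}(\mathbb B-\mathbb B^*)$. Let $T$ be an operator in $\mathcal H$ with non-empty set $\rho(T)$ of regular points and $D(A)=D(T)\cap D(T^*)$, and let $\mathbb A\in[\mathcal H_+,\mathcal H_-]$ be a $(*)$-extension of $T$: $\mathbb A\supset T\supset A$, $\mathbb A^*\supset T^*\supset A$, and $\mathrm{Re}\,\mathbb A$ is a self-adjoint bi-extension of $A$, i.e. $\mathrm{Re}\,\mathbb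 A\supset A$ and the operator $f\mapsto(\mathrm{Re}\,\mathbb A)f$ with domain $\{f\in\mathcal H_+:(\mathrm{Re}\,\mathbb A)f\in\mathcal H\}$ is self-adjoint in $\mathcal H$. Let $E$ be a finite-dimensional Hilbert space, $J\in[E,E]$ with $J=J^*=J^{-1}$, and $K\in[E,\mathcal H_-]$ with adjoint $K^*\in[\mathcal H_+,E]$, such that $\mathrm{Im}\,\mathbb A=KJK^*$. These data form a rigged canonical system $\Theta$ of the Livsic type. Assume that $\Theta$ is prime: the closed linear span of the subspaces $\mathfrak N_\lambda=\ker(A^*-\lambda I)$, over the non-real $\lambda\in\rho(T)$, is $\mathcal H$. Assume also that $\mathrm{Ran}\,K\subset\mathrm{Ran}(\mathrm{Im}\,\mathbb A)+\mathcal H$ (which holds automatically if $J=I$ or if $K$ is injective). Then for every non-real $z$ the operator $\mathrm{Re}\,\mathbb A-zI:\mathcal H_+\to\mathcal H_-$ is injective with range containing $\mathrm{Ran}\,K$, so that $$V_\Theta(z)=K^*(\mathrm{Re}\,\mathbb A-zI)^{-1}K\in[E,E]$$ is well defined, and $V_\Theta$ is a Stieltjes function if and only if $\mathbb A$ is accretive,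 i.e. $\mathrm{Re}\,(\mathbb Af,f)\ge0$ for all $f\in\mathcal H_+$. Here a function $V:\mathbb C\setminus\mathbb R\to[E,E]$ is a Stieltjes function if it is a Herglotz–Nevanlinna function (holomorphic on $\mathbb C\setminus\mathbb R$, $V(z)^*=V(\bar z)$, and $\mathrm{Im}\,V(z)\ge0$ for $\mathrm{Im}\,z>0$) that admits a representation $$V(z)=\gamma+\int_0^\infty\frac{dG(t)}{t-z},\qquad z\in\mathbb C\setminus\mathbb R,$$ with $\gamma\ge0$ and a non-decreasing operator-valued function $G$ on $[0,\infty)$ such that $\int_0^\infty\frac{(dG(t)e,e)_E}{1+t}<\infty$ for all $e\in E$. -/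

import Mathlib

open scoped InnerProductSpace LinearPMap ComplexConjugate

/- Over `ℂ`, let `inner` be found through `InnerProductSpace` and not through `CStarModule` (the
two are definitionally equal). -/
attribute [local instance 2000] InnerProductSpace.toInner

noncomputable section

namespace RiggedSystem

section Triplet

variable {H : Type*} [NormedAddCommGroup H] [InnerProductSpace ℂ H] [CompleteSpace H]

/-- The space `H₊ = D(A*)`. It is a separate type (not a subtype of `H` as far as instances are
concerned), since it carries the norm of the graph of `A*`. -/
def HPlus (A : H →ₗ.[ℂ] H) : Type _ := A†.domain

variable (A : H →ₗ.[ℂ] H)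

/-- The inner product `(f, g)₊ = (f, g) + (A* f, A* g)` on `D(A*)`. -/
abbrev HPlus.core : InnerProductSpace.Core ℂ A†.domain where
  inner f g := ⟪(f : H), (g : H)⟫_ℂ + ⟪A† f, A† g⟫_ℂ
  conj_inner_symm f g := by simp [inner_conj_symm]
  re_inner_nonneg f := by
    have h1 := inner_self_nonneg (𝕜 := ℂ) (x := (f : H))
    have h2 := inner_self_nonneg (𝕜 := ℂ) (x := A† f)
    simpa only [map_add] using add_nonneg h1 h2
  add_left f g h := by
    simp only [LinearPMap.map_add, Submodule.coe_add, inner_add_left]; ring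
  smul_left f g c := by
    simp only [LinearPMap.map_smul, Submodule.coe_smul, inner_smul_left]; ring
  definite f hf := by
    have h1 := inner_self_nonneg (𝕜 := ℂ) (x := (f : H))
    have h2 := inner_self_nonneg (𝕜 := ℂ) (x := A† f)
    have h3 := congrArg (RCLike.re (K := ℂ)) hf
    simp only [map_add, map_zero] at h3
    have h4 : RCLike.re ⟪(f : H), (f : H)⟫_ℂ = 0 := by linarith
    exact Subtype.ext (re_inner_self_nonpos.mp h4.le)

instance : NormedAddCommGroup (HPlus A) := (HPlus.core A).toNormedAddCommGroup

instance : InnerProductSpace ℂ (HPlus A) := InnerProductSpace.ofCore (HPlus.core A).toCore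

/-- The inclusion `H₊ ⊂ H`. -/
def HPlus.incl : HPlus A →ₗ[ℂ] H where
  toFun f := (show A†.domain from f).1
  map_add' _ _ := rfl
  map_smul' _ _ := rfl

/-- The operator `A*`, as a linear map on `H₊`. -/
def HPlus.star : HPlus A →ₗ[ℂ] H where
  toFun f := A† (show A†.domain from f)
  map_add' f g := A†.toFun.map_add f g
  map_smul' c f := A†.toFun.map_smul c f

theorem HPlus.inner_def (f g : HPlus A) :
    ⟪f, g⟫_ℂ = ⟪HPlus.incl A f, HPlus.incl A g⟫_ℂ + ⟪HPlus.star A f, HPlus.star A g⟫_ℂ := rfl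

theorem HPlus.norm_incl_le (f : HPlus A) : ‖HPlus.incl A f‖ ≤ 1 * ‖f‖ := by
  have h0 : ‖f‖ ^ 2 = ‖HPlus.incl A f‖ ^ 2 + ‖HPlus.star A f‖ ^ 2 := by
    rw [← inner_self_eq_norm_sq (𝕜 := ℂ) f, HPlus.inner_def, map_add,
      inner_self_eq_norm_sq, inner_self_eq_norm_sq]
  rw [one_mul]
  exact le_of_sq_le_sq (by nlinarith [sq_nonneg ‖HPlus.star A f‖]) (norm_nonneg _)

/-- The bounded inclusion `H₊ ⊂ H`. -/
def HPlus.inclL : HPlus A →L[ℂ] H := (HPlus.incl A).mkContinuous 1 (HPlus.norm_incl_le A)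

/-- The space `H₋`: bounded conjugate-linear functionals on `H₊`. For `φ ∈ H₋` and `f ∈ H₊` the
value `φ f` is the pairing `(φ, f)`, linear in `φ` and conjugate-linear in `f`. -/
abbrev HMinus : Type _ := HPlus A →L⋆[ℂ] ℂ

/-- The inclusion `H ⊂ H₋`, where `h` acts by `f ↦ (h, f)`. -/
def HMinus.ofH : H →L[ℂ] HMinus A :=
  ((innerSL ℂ : H →L⋆[ℂ] H →L[ℂ] ℂ).comp (HPlus.inclL A)).flip

theorem HMinus.ofH_apply (h : H) (f : HPlus A) : HMinus.ofH A h f = ⟪HPlus.incl A f, h⟫_ℂ := rfl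

variable {A}

/-- The adjoint `B* ∈ [H₊, H₋]` of `B ∈ [H₊, H₋]`: `(B* f, g) = (f, B g)`, where `(f, φ)` is the
conjugate of `(φ, f)`. -/
def adj (B : HPlus A →L[ℂ] HMinus A) : HPlus A →L[ℂ] HMinus A :=
  LinearMap.mkContinuous₂
    (LinearMap.mk₂'ₛₗ (RingHom.id ℂ) (starRingEnd ℂ) (fun f g => conj (B g f))
      (by intros; simp) (by intros; simp) (by intros; simp) (by intros; simp))
    ‖B‖ (by
      intro f g
      have := B.le_opNorm₂ g f
      simp only [LinearMap.mk₂'ₛₗ_apply, RCLike.norm_conj]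
      linarith [mul_right_comm ‖B‖ ‖f‖ ‖g‖])

theorem adj_apply (B : HPlus A →L[ℂ] HMinus A) (f g : HPlus A) : adj B f g = conj (B g f) := rfl

/-- The real part `(B + B*) / 2`. -/
def rePart (B : HPlus A →L[ℂ] HMinus A) : HPlus A →L[ℂ] HMinus A := (1 / 2 : ℂ) • (B + adj B)

/-- The imaginary part `(B - B*) / (2i)`. -/
def imPart (B : HPlus A →L[ℂ] HMinus A) : HPlus A →L[ℂ] HMinus A :=
  (1 / (2 * Complex.I) : ℂ) • (B - adj B)

/-- `B ⊃ S` for `B ∈ [H₊, H₋]` and an operator `S` in `H`: `D(S) ⊂ H₊` and `B f = S f` for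
`f ∈ D(S)`. -/
def Extends (B : HPlus A →L[ℂ] HMinus A) (S : H →ₗ.[ℂ] H) : Prop :=
  ∀ s : S.domain, ∃ f : HPlus A, HPlus.incl A f = s ∧ B f = HMinus.ofH A (S s)

/-- The quasi-kernel of `B ∈ [H₊, H₋]`: the operator `f ↦ B f` in `H` with domain
`{f ∈ H₊ : B f ∈ H}`, given here by its graph (a graph as soon as `D(A*)` is dense in `H`). -/
def quasiKernel (B : HPlus A →L[ℂ] HMinus A) : H →ₗ.[ℂ] H :=
  Submodule.toLinearPMap
    { carrier := {p | ∃ f : HPlus A, HPlus.incl A f = p.1 ∧ B f = HMinus.ofH A p.2}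
      add_mem' := by
        rintro p q ⟨f, hf, hf'⟩ ⟨g, hg, hg'⟩
        exact ⟨f + g, by simp [hf, hg], by simp [hf', hg']⟩
      zero_mem' := ⟨0, by simp, by simp⟩
      smul_mem' := by
        rintro c p ⟨f, hf, hf'⟩
        exact ⟨c • f, by simp [hf], by simp [hf']⟩ }

/-- Self-adjoint bi-extensions of the symmetric operator `A`. -/
structure IsSelfAdjointBiExtension (B : HPlus A →L[ℂ] HMinus A) : Prop where
  adj_eq : adj B = B
  extends_base : Extends B A
  isSelfAdjoint_quasiKernel : IsSelfAdjoint (quasiKernel B)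

/-- `z` is a regular point of `T`: `T - z I` maps `D(T)` bijectively onto `H`, with a bounded
inverse. -/
def IsRegularPoint (T : H →ₗ.[ℂ] H) (z : ℂ) : Prop :=
  ∃ R : H →L[ℂ] H,
    (∀ h : H, ∃ f : T.domain, (f : H) = R h ∧ T f - z • (f : H) = h) ∧
    ∀ f : T.domain, R (T f - z • (f : H)) = f

/-- `(*)`-extensions `B` of an operator `T` with `ρ(T) ≠ ∅`: `B ⊃ T ⊃ A`, `B* ⊃ T* ⊃ A` and
the real part of `B` is a self-adjoint bi-extension of `A`. -/
structure IsStarExtension (B : HPlus A →L[ℂ] HMinus A) (T : H →ₗ.[ℂ] H) : Prop where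
  exists_regularPoint : ∃ z, IsRegularPoint T z
  le_T : A ≤ T
  le_T_adjoint : A ≤ T†
  extends_T : Extends B T
  adj_extends_T_adjoint : Extends (adj B) T†
  rePart_biExtension : IsSelfAdjointBiExtension (rePart B)

/-- `B ∈ [H₊, H₋]` is accretive: `Re (B f, f) ≥ 0` for all `f ∈ H₊`. -/
def IsAccretive (B : HPlus A →L[ℂ] HMinus A) : Prop := ∀ f : HPlus A, 0 ≤ (B f f).re

variable (A) in
/-- The defect subspace `𝔑_z = ker (A* - z I)`, as a subspace of `H`. -/
def defect (z : ℂ) : Submodule ℂ H :=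
  (LinearMap.ker (HPlus.star A - z • HPlus.incl A)).map (HPlus.incl A)

end Triplet

section System

variable {H : Type*} [NormedAddCommGroup H] [InnerProductSpace ℂ H] [CompleteSpace H]
variable {E : Type*} [NormedAddCommGroup E] [InnerProductSpace ℂ E] [FiniteDimensional ℂ E]

/-- The adjoint `K* ∈ [H₊, E]` of `K ∈ [E, H₋]`: `(K* f, e)_E = (f, K e)`. -/
def channelAdj {A : H →ₗ.[ℂ] H} (K : E →L[ℂ] HMinus A) : HPlus A →L[ℂ] E :=
  haveI : CompleteSpace E := FiniteDimensional.complete ℂ E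
  ((InnerProductSpace.toDual ℂ E).symm.toContinuousLinearEquiv :
    (E →L[ℂ] ℂ) →L⋆[ℂ] E).comp K.flip

theorem inner_channelAdj {A : H →ₗ.[ℂ] H} (K : E →L[ℂ] HMinus A) (f : HPlus A) (e : E) :
    ⟪e, channelAdj K f⟫_ℂ = conj (K e f) := by
  have : CompleteSpace E := FiniteDimensional.complete ℂ E
  rw [← inner_conj_symm]
  congr 1
  exact InnerProductSpace.toDual_symm_apply

end System

end RiggedSystem

open RiggedSystem

/-- A rigged canonical system of the Livsic type with state space `H` and input-output space `E`:
the array `(𝔸, K, J; H₊ ⊂ H ⊂ H₋, E)`, together with the closed densely defined symmetric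
operator `A` (of finite equal deficiency indices) that determines the triplet, and the operator `T`
of which `𝔸` is a `(*)`-extension. -/
structure RiggedCanonicalSystem (H E : Type*)
    [NormedAddCommGroup H] [InnerProductSpace ℂ H] [CompleteSpace H]
    [NormedAddCommGroup E] [InnerProductSpace ℂ E] [FiniteDimensional ℂ E] where
  /-- the symmetric operator -/
  A : H →ₗ.[ℂ] H
  isClosed_A : A.IsClosed
  dense_A : Dense (A.domain : Set H)
  symmetric_A : A.IsFormalAdjoint A
  finite_defect : FiniteDimensional ℂ (defect A Complex.I)
  finite_defect' : FiniteDimensional ℂ (defect A (-Complex.I))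
  defect_eq :
    Module.finrank ℂ (defect A Complex.I) = Module.finrank ℂ (defect A (-Complex.I))
  /-- the operator `T`, with `A ⊂ T ⊂ A*` -/
  T : H →ₗ.[ℂ] H
  domain_A : A.domain = T.domain ⊓ T†.domain
  /-- the main operator -/
  main : HPlus A →L[ℂ] HMinus A
  isStarExtension : IsStarExtension main T
  /-- the direction operator -/
  J : E →L[ℂ] E
  J_selfAdjoint : ∀ x y : E, ⟪J x, y⟫_ℂ = ⟪x, J y⟫_ℂ
  J_involutive : ∀ x : E, J (J x) = x
  /-- the channel operator -/
  K : E →L[ℂ] HMinus A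
  imPart_main : imPart main = K.comp (J.comp (channelAdj K))

namespace RiggedCanonicalSystem

variable {H E : Type*}
  [NormedAddCommGroup H] [InnerProductSpace ℂ H] [CompleteSpace H]
  [NormedAddCommGroup E] [InnerProductSpace ℂ E] [FiniteDimensional ℂ E]

/-- The system is prime: the closed linear span of the defect subspaces `𝔑_z`, over the non-real
regular points `z` of `T`, is `H`. -/
def IsPrime (Θ : RiggedCanonicalSystem H E) : Prop :=
  (⨆ z ∈ {z : ℂ | z.im ≠ 0 ∧ IsRegularPoint Θ.T z}, defect Θ.A z).topologicalClosure = ⊤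

/-- The operator `Re 𝔸 - z I ∈ [H₊, H₋]`. -/
def shifted (Θ : RiggedCanonicalSystem H E) (z : ℂ) : HPlus Θ.A →L[ℂ] HMinus Θ.A :=
  rePart Θ.main - z • (HMinus.ofH Θ.A).comp (HPlus.inclL Θ.A)

/-- The expression `K* (Re 𝔸 - z I)⁻¹ K` makes sense at `z`: the operator `Re 𝔸 - z I` is
injective and its range contains that of `K`. -/
def IsDefinedAt (Θ : RiggedCanonicalSystem H E) (z : ℂ) : Prop :=
  Function.Injective (Θ.shifted z) ∧ ∀ e : E, ∃ f : HPlus Θ.A, Θ.shifted z f = Θ.K e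

/-- `(Re 𝔸 - z I)⁻¹ K` as a linear map from `E` to `H₊`, at a point where it makes sense. -/
def invK (Θ : RiggedCanonicalSystem H E) {z : ℂ} (h : Θ.IsDefinedAt z) : E →ₗ[ℂ] HPlus Θ.A :=
  (LinearEquiv.ofInjective (Θ.shifted z).toLinearMap h.1).symm.toLinearMap.comp
    (LinearMap.codRestrict (LinearMap.range (Θ.shifted z).toLinearMap) Θ.K.toLinearMap
      (fun e => h.2 e))

theorem shifted_invK (Θ : RiggedCanonicalSystem H E) {z : ℂ} (h : Θ.IsDefinedAt z) (e : E) :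
    Θ.shifted z (Θ.invK h e) = Θ.K e :=
  congrArg Subtype.val ((LinearEquiv.ofInjective (Θ.shifted z).toLinearMap h.1).apply_symm_apply
    (LinearMap.codRestrict (LinearMap.range (Θ.shifted z).toLinearMap) Θ.K.toLinearMap
      (fun e => h.2 e) e))

open Classical in
/-- The function `V_Θ(z) = K* (Re 𝔸 - z I)⁻¹ K` (with value `0` where this makes no sense). -/
def V (Θ : RiggedCanonicalSystem H E) (z : ℂ) : E →L[ℂ] E :=
  if h : Θ.IsDefinedAt z then
    LinearMap.toContinuousLinearMap ((channelAdj Θ.K).toLinearMap.comp (Θ.invK h))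
  else 0

end RiggedCanonicalSystem

section Stieltjes

variable {E : Type*} [NormedAddCommGroup E] [InnerProductSpace ℂ E]

/-- Operator-valued Herglotz-Nevanlinna functions on `ℂ \ ℝ`. -/
structure IsHerglotzNevanlinna (V : ℂ → E →L[ℂ] E) : Prop where
  differentiableOn : DifferentiableOn ℂ V {z | z.im ≠ 0}
  symm : ∀ z : ℂ, z.im ≠ 0 → ∀ x y : E, ⟪V z x, y⟫_ℂ = ⟪x, V (conj z) y⟫_ℂ
  im_nonneg : ∀ z : ℂ, 0 < z.im → ∀ e : E, 0 ≤ (⟪e, V z e⟫_ℂ).im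

/-- `G` is non-decreasing on `[0, ∞)`. -/
def NondecreasingOp (G : ℝ → E →L[ℂ] E) : Prop :=
  ∀ s t : ℝ, 0 ≤ s → s ≤ t → (G t - G s).IsPositive

theorem NondecreasingOp.monotone {G : ℝ → E →L[ℂ] E} (hG : NondecreasingOp G) (e : E) :
    Monotone fun t : ℝ => (⟪e, G (max t 0) e⟫_ℂ).re := by
  intro s t hst
  have h := (hG (max s 0) (max t 0) (le_max_right _ _) (max_le_max_right 0 hst)).re_inner_nonneg_right e
  rw [sub_apply, inner_sub_right, map_sub] at h
  simpa using sub_nonneg.mp h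

/-- The measure `(dG(t) e, e)` on `[0, ∞)`, as a measure on `ℝ`. The function `t ↦ (G(t) e, e)` is
extended to `t < 0` by its value at `0`, so that a jump `G(0+) - G(0)` gives mass to `{0}`, as it
does in the Riemann-Stieltjes integral over `[0, ∞)`. -/
def NondecreasingOp.measure {G : ℝ → E →L[ℂ] E} (hG : NondecreasingOp G) (e : E) :
    MeasureTheory.Measure ℝ :=
  (hG.monotone e).stieltjesFunction.measure

/-- Operator-valued Stieltjes functions: Herglotz-Nevanlinna functions of the form
`V(z) = γ + ∫₀^∞ dG(t) / (t - z)` with `γ ≥ 0`, `G` non-decreasing on `[0, ∞)`, and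
`∫₀^∞ (dG(t) e, e) / (1 + t) < ∞` for all `e`. The operator integral is understood through its
quadratic form. -/
def IsStieltjes (V : ℂ → E →L[ℂ] E) : Prop :=
  IsHerglotzNevanlinna V ∧
  ∃ (γ : E →L[ℂ] E) (G : ℝ → E →L[ℂ] E) (hG : NondecreasingOp G),
    γ.IsPositive ∧
    (∀ e : E, MeasureTheory.IntegrableOn (fun t : ℝ => 1 / (1 + t)) (Set.Ici 0) (hG.measure e)) ∧
    ∀ z : ℂ, z.im ≠ 0 → ∀ e : E,
      ⟪e, V z e⟫_ℂ = ⟪e, γ e⟫_ℂ + ∫ t in Set.Ici (0 : ℝ), 1 / ((t : ℂ) - z) ∂(hG.measure e)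

end Stieltjes

end

/-! The kernel identity `(Re 𝔸 u, v) = (z (V(z) e, e') - w̄ (e, V(w) e')) / (z - w̄)`, valid when
`(Re 𝔸 - z) u = K e` and `(Re 𝔸 - w) v = K e'`, turns the accretivity of `𝔸` on the span of the
defect vectors into the positivity of a kernel built from `V`; primeness makes that span dense in
`H₊`. The kernel of a Stieltjes function is positive since it is so for positive constants and for
`1 / (t - z)` with `t ≥ 0`.

Conversely, if `𝔸` is accretive, the resolvent `C = (Re 𝔸 + I)⁻¹` has its spectrum in `[0, 1]`, and
expanding `V` about `-1` by the resolvent identity expresses it through the spectral measures `μ` of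
`C`. The substitution `s = 1 / (1 + t)` turns the integral over `[0, 1]` into the one over `[0, ∞)`.
The mass of `μ` at `0` vanishes and `∫ s⁻¹ dμ ≤ V(-1)` because, by the Cauchy-Schwarz inequality for
the form of `Re 𝔸 + I`, the vectors `(Re 𝔸 + I)⁻¹ K e` are dominated by that form; this gives the
integrability condition and `γ ≥ 0`. -/

open RiggedSystem MeasureTheory Filter Topology Set CompactlySupported

section QuadraticForms

variable {E : Type*} [NormedAddCommGroup E] [InnerProductSpace ℂ E]

theorem inner_map_eq_quadratic (M : E →L[ℂ] E) (x y : E) :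
    ⟪x, M y⟫_ℂ = (⟪x + y, M (x + y)⟫_ℂ - ⟪x - y, M (x - y)⟫_ℂ
      - Complex.I * ⟪x + Complex.I • y, M (x + Complex.I • y)⟫_ℂ
      + Complex.I * ⟪x - Complex.I • y, M (x - Complex.I • y)⟫_ℂ) / 4 := by
  have hconj : ∀ u v, ⟪u, M v⟫_ℂ = conj ⟪(M : E →ₗ[ℂ] E) v, u⟫_ℂ := fun u v =>
    (inner_conj_symm _ _).symm
  simp only [hconj]
  rw [inner_map_polarization]
  simp only [map_div₀, map_sub, map_add, map_mul, Complex.conj_I, map_ofNat]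
  ring

theorem exists_tendsto_inner_map_of_quadratic {α : Type*} {l : Filter α} {M : α → E →L[ℂ] E}
    {c : E → ℂ} (h : ∀ e, Tendsto (fun a => ⟪e, M a e⟫_ℂ) l (𝓝 (c e))) (x y : E) :
    ∃ d, Tendsto (fun a => ⟪x, M a y⟫_ℂ) l (𝓝 d) := by
  simp only [inner_map_eq_quadratic _ x y]
  exact ⟨_, ((((h _).sub (h _)).sub ((h _).const_mul _)).add ((h _).const_mul _)).div_const _⟩

theorem tendsto_inner_map_of_quadratic {α : Type*} {l : Filter α} {M : α → E →L[ℂ] E}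
    {N : E →L[ℂ] E} (h : ∀ e, Tendsto (fun a => ⟪e, M a e⟫_ℂ) l (𝓝 ⟪e, N e⟫_ℂ)) (x y : E) :
    Tendsto (fun a => ⟪x, M a y⟫_ℂ) l (𝓝 ⟪x, N y⟫_ℂ) := by
  simp only [inner_map_eq_quadratic _ x y]
  exact ((((h _).sub (h _)).sub ((h _).const_mul _)).add ((h _).const_mul _)).div_const _

theorem exists_inner_map_eq_of_tendsto [FiniteDimensional ℂ E] {α : Type*} {l : Filter α}
    [l.NeBot] {M : α → E →L[ℂ] E} {c : E → ℂ}
    (h : ∀ e, Tendsto (fun a => ⟪e, M a e⟫_ℂ) l (𝓝 (c e))) :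
    ∃ N : E →L[ℂ] E, ∀ e, ⟪e, N e⟫_ℂ = c e := by
  choose d hd using exists_tendsto_inner_map_of_quadratic h
  let b := stdOrthonormalBasis ℂ E
  have hlim : Tendsto (fun a x => (M a : E →ₗ[ℂ] E) x) l (𝓝 fun y => ∑ i, d (b i) y • b i) := by
    refine tendsto_pi_nhds.2 fun y => ?_
    have hsum : (fun a => (M a : E →ₗ[ℂ] E) y) = fun a => ∑ i, ⟪b i, M a y⟫_ℂ • b i :=
      funext fun a => (b.sum_repr' _).symm
    rw [hsum]
    exact tendsto_finsetSum _ fun i _ => (hd _ _).smul_const _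
  refine ⟨LinearMap.toContinuousLinearMap (linearMapOfTendsto _ _ hlim), fun e => ?_⟩
  exact tendsto_nhds_unique ((tendsto_const_nhds (x := e)).inner (tendsto_pi_nhds.1 hlim e)) (h e)

theorem isPositive_of_inner_eq_ofReal {M : E →L[ℂ] E} {q : E → ℝ}
    (h : ∀ e, ⟪e, M e⟫_ℂ = q e) (hq : ∀ e, 0 ≤ q e) : M.IsPositive := by
  refine (ContinuousLinearMap.isPositive_iff_complex M).2 fun e => ?_
  have he : ⟪M e, e⟫_ℂ = q e := by rw [← inner_conj_symm, h, Complex.conj_ofReal]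
  rw [he]
  exact ⟨rfl, hq e⟩

end QuadraticForms

section SpectralMeasure

variable {H : Type*} [NormedAddCommGroup H] [InnerProductSpace ℂ H] [CompleteSpace H]
variable {C : H →L[ℂ] H}

/-- The positive functional `φ ↦ (φ(C) x, x)` on the continuous functions on the spectrum of a
bounded self-adjoint operator. They are taken compactly supported, as in the
Riesz–Markov–Kakutani theorem. -/
noncomputable def spectralFunctional (hC : IsSelfAdjoint C) (x : H) :
    C_c(spectrum ℝ C, ℝ) →ₚ[ℝ] ℝ :=
  PositiveLinearMap.mk₀
    { toFun := fun φ => (⟪x, cfcHom hC φ.toContinuousMap x⟫_ℂ).re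
      map_add' := fun φ ψ => by
        have : (φ + ψ).toContinuousMap = φ.toContinuousMap + ψ.toContinuousMap := rfl
        simp only [this, map_add, add_apply, inner_add_right, Complex.add_re]
      map_smul' := fun c φ => by
        have : (c • φ).toContinuousMap = c • φ.toContinuousMap := rfl
        rw [this, map_smul, smul_apply, ← Complex.coe_smul, inner_smul_right,
          Complex.re_ofReal_mul]
        rfl }
    fun φ hφ => by
      have hpos : 0 ≤ cfcHom hC φ.toContinuousMap := (cfcHom_nonneg_iff hC).2 fun s => hφ s
      exact ((ContinuousLinearMap.nonneg_iff_isPositive _).1 hpos).re_inner_nonneg_right x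

/-- The spectral measure `(dE(s) x, x)` of a bounded self-adjoint operator at the vector `x`. -/
noncomputable def spectralMeasure (hC : IsSelfAdjoint C) (x : H) : Measure ℝ :=
  (RealRMK.rieszMeasure (spectralFunctional hC x)).map Subtype.val

instance (hC : IsSelfAdjoint C) (x : H) : IsFiniteMeasure (spectralMeasure hC x) :=
  Measure.isFiniteMeasure_map _ _

theorem measurableEmbedding_coe_spectrum (C : H →L[ℂ] H) :
    MeasurableEmbedding (Subtype.val : spectrum ℝ C → ℝ) :=
  MeasurableEmbedding.subtype_coe
    (ContinuousFunctionalCalculus.isCompact_spectrum C).isClosed.measurableSet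

theorem ae_mem_spectrum (hC : IsSelfAdjoint C) (x : H) :
    ∀ᵐ s ∂(spectralMeasure hC x), s ∈ spectrum ℝ C :=
  (measurableEmbedding_coe_spectrum C).ae_map_iff.2 (Eventually.of_forall Subtype.property)

theorem integrable_spectralMeasure (hC : IsSelfAdjoint C) (x : H) {G : Type*}
    [NormedAddCommGroup G] {φ : ℝ → G} (hφ : ContinuousOn φ (spectrum ℝ C)) :
    Integrable φ (spectralMeasure hC x) := by
  have h := hφ.integrableOn_compact (μ := spectralMeasure hC x)
    (ContinuousFunctionalCalculus.isCompact_spectrum C)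
  rwa [IntegrableOn, Measure.restrict_eq_self_of_ae_mem (ae_mem_spectrum hC x)] at h

theorem inner_cfc_eq_integral (hC : IsSelfAdjoint C) (x : H) {φ : ℝ → ℝ}
    (hφ : ContinuousOn φ (spectrum ℝ C)) :
    ⟪x, cfc φ C x⟫_ℂ = ∫ s, φ s ∂(spectralMeasure hC x) := by
  have hreal : ⟪x, cfc φ C x⟫_ℂ = (⟪x, cfc φ C x⟫_ℂ).re :=
    ((cfc_predicate φ C).isSymmetric.coe_re_inner_self_apply x).symm
  rw [hreal, cfc_apply φ C, spectralMeasure, (measurableEmbedding_coe_spectrum C).integral_map]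
  exact congrArg _ (RealRMK.integral_rieszMeasure (spectralFunctional hC x)
    (CompactlySupportedContinuousMap.continuousMapEquiv ⟨_, hφ.domRestrict⟩)).symm

theorem cfc_eq_cfc_re_add_I_smul_cfc_im (hC : IsSelfAdjoint C) {f : ℂ → ℂ}
    (hf : ContinuousOn f (spectrum ℂ C)) :
    cfc f C = cfc (fun s : ℝ => (f s).re) C + Complex.I • cfc (fun s : ℝ => (f s).im) C := by
  have hre : ContinuousOn (fun w => ((f w).re : ℂ)) (spectrum ℂ C) := by fun_prop
  have him : ContinuousOn (fun w => ((f w).im : ℂ)) (spectrum ℂ C) := by fun_prop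
  have hreal : ∀ φ : ℂ → ℝ, cfc (fun w => (φ w : ℂ)) C = cfc (fun s : ℝ => φ s) C := fun φ => by
    rw [cfc_complex_eq_real C fun w _ => Complex.conj_ofReal _]
    rfl
  rw [← hreal fun w => (f w).re, ← hreal fun w => (f w).im, ← cfc_smul Complex.I _ C him,
    ← cfc_add C _ (fun w => Complex.I • ((f w).im : ℂ)) hre (him.const_smul Complex.I)]
  refine cfc_congr fun w _ => ?_
  simp only [smul_eq_mul, mul_comm Complex.I, Complex.re_add_im]

theorem inner_cfc_complex_eq_integral (hC : IsSelfAdjoint C) (x : H) {f : ℂ → ℂ}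
    (hf : ContinuousOn f (spectrum ℂ C)) :
    ⟪x, cfc f C x⟫_ℂ = ∫ s : ℝ, f s ∂(spectralMeasure hC x) := by
  have hmem : MapsTo Complex.ofReal (spectrum ℝ C) (spectrum ℂ C) := fun s hs =>
    (spectrum.algebraMap_mem_iff ℂ).2 hs
  have hfR : ContinuousOn (fun s : ℝ => f s) (spectrum ℝ C) :=
    hf.comp Complex.continuous_ofReal.continuousOn hmem
  have hre : ContinuousOn (fun s : ℝ => (f s).re) (spectrum ℝ C) := by fun_prop
  have him : ContinuousOn (fun s : ℝ => (f s).im) (spectrum ℝ C) := by fun_prop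
  rw [cfc_eq_cfc_re_add_I_smul_cfc_im hC hf, add_apply, smul_apply, inner_add_right,
    inner_smul_right, inner_cfc_eq_integral hC x hre, inner_cfc_eq_integral hC x him,
    mul_comm Complex.I]
  exact integral_re_add_im (integrable_spectralMeasure hC x hfR)

theorem one_sub_mul_ne_zero {ζ : ℂ} (hζ : ζ.im ≠ 0) (s : ℝ) : 1 - ζ * s ≠ 0 := by
  intro h
  have him : s = 0 := by simpa [hζ] using congrArg Complex.im h
  simp [him] at h

theorem one_sub_mul_ne_zero_of_mem_spectrum (hC : IsSelfAdjoint C) {ζ : ℂ} (hζ : ζ.im ≠ 0) {w : ℂ}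
    (hw : w ∈ spectrum ℂ C) : 1 - ζ * w ≠ 0 := by
  rw [hC.mem_spectrum_eq_re hw]
  exact one_sub_mul_ne_zero hζ _

theorem cfc_one_sub_mul (hC : IsSelfAdjoint C) (ζ : ℂ) :
    cfc (fun w : ℂ => 1 - ζ * w) C = 1 - ζ • C := by
  rw [cfc_sub (fun _ => 1) (fun w => ζ * w) C, cfc_const_one ℂ C, cfc_const_mul_id ζ C]

theorem isUnit_one_sub_smul (hC : IsSelfAdjoint C) {ζ : ℂ} (hζ : ζ.im ≠ 0) :
    IsUnit (1 - ζ • C) := by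
  rw [← cfc_one_sub_mul hC]
  exact isUnit_cfc _ C (by fun_prop) hC.isStarNormal fun w hw =>
    one_sub_mul_ne_zero_of_mem_spectrum hC hζ hw

theorem inner_inverse_one_sub_smul_eq_integral (hC : IsSelfAdjoint C) (x : H) {ζ : ℂ}
    (hζ : ζ.im ≠ 0) :
    ⟪x, Ring.inverse (1 - ζ • C) x⟫_ℂ = ∫ s : ℝ, (1 - ζ * s)⁻¹ ∂(spectralMeasure hC x) := by
  have hne := fun w => one_sub_mul_ne_zero_of_mem_spectrum hC hζ (w := w)
  rw [← cfc_one_sub_mul hC, ← cfc_inv _ C hne]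
  have hcont : Continuous fun w : ℂ => 1 - ζ * w := by fun_prop
  exact inner_cfc_complex_eq_integral hC x (hcont.continuousOn.inv₀ hne)

end SpectralMeasure

section Inversion

/-- The image of `s⁻² ν` under `s ↦ s⁻¹ - 1`, the change of variables that takes the spectrum of
`(B + 1)⁻¹` to that of `B`. -/
noncomputable def inversionMeasure (ν : Measure ℝ) : Measure ℝ :=
  (ν.withDensity fun s => (Real.toNNReal (s⁻¹ ^ 2) : ENNReal)).map fun s => s⁻¹ - 1

variable {ν : Measure ℝ} {G : Type*} [NormedAddCommGroup G] [NormedSpace ℝ G] {φ : ℝ → G}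

theorem integral_inversionMeasure (hφ : StronglyMeasurable φ) :
    ∫ t, φ t ∂(inversionMeasure ν) = ∫ s : ℝ, s⁻¹ ^ 2 • φ (s⁻¹ - 1) ∂ν := by
  rw [inversionMeasure, integral_map (by fun_prop) hφ.aestronglyMeasurable,
    integral_withDensity_eq_integral_smul (by fun_prop)]
  simp only [NNReal.smul_def, Real.coe_toNNReal _ (sq_nonneg _)]

theorem integrable_inversionMeasure_iff (hφ : StronglyMeasurable φ) :
    Integrable φ (inversionMeasure ν) ↔ Integrable (fun s => s⁻¹ ^ 2 • φ (s⁻¹ - 1)) ν := by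
  rw [inversionMeasure, integrable_map_measure hφ.aestronglyMeasurable (by fun_prop),
    integrable_withDensity_iff_integrable_smul (by fun_prop)]
  simp only [NNReal.smul_def, Real.coe_toNNReal _ (sq_nonneg _), Function.comp_apply]

theorem ae_inversionMeasure_nonneg (hν : ∀ᵐ s ∂ν, s ∈ Ioc (0 : ℝ) 1) :
    ∀ᵐ t ∂(inversionMeasure ν), 0 ≤ t := by
  refine (ae_map_iff (by fun_prop) measurableSet_Ici).2
    ((withDensity_absolutelyContinuous _ _).ae_le ?_)
  filter_upwards [hν] with s hs
  exact sub_nonneg.2 ((one_le_inv₀ hs.1).2 hs.2)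

theorem inv_sq_smul_indicator_Iio {s t : ℝ} (hs : 0 < s) (ht : 0 ≤ t) :
    s⁻¹ ^ 2 • (Iio t).indicator (1 : ℝ → ℝ) (s⁻¹ - 1) =
      (Ioi (1 + t)⁻¹).indicator (fun s => s⁻¹ ^ 2) s := by
  have hiff : s⁻¹ - 1 < t ↔ (1 + t)⁻¹ < s := by
    rw [inv_lt_comm₀ (by linarith) hs, sub_lt_iff_lt_add']
  simp only [indicator_apply, mem_Iio, mem_Ioi, hiff, Pi.one_apply, smul_eq_mul, mul_ite,
    mul_zero, mul_one]

theorem norm_indicator_inv_sq_le {a : ℝ} (ha : 0 < a) (s : ℝ) :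
    ‖(Ioi a).indicator (fun s : ℝ => s⁻¹ ^ 2) s‖ ≤ a⁻¹ ^ 2 := by
  by_cases h : s ∈ Ioi a
  · have : s⁻¹ ≤ a⁻¹ := inv_anti₀ ha (le_of_lt h)
    have : 0 ≤ s⁻¹ := inv_nonneg.2 (ha.le.trans (le_of_lt h))
    rw [indicator_of_mem h, Real.norm_of_nonneg (sq_nonneg _)]
    gcongr
  · rw [indicator_of_notMem h, norm_zero]
    positivity

theorem integrable_indicator_inv_sq [IsFiniteMeasure ν] {a : ℝ} (ha : 0 < a) :
    Integrable ((Ioi a).indicator fun s : ℝ => s⁻¹ ^ 2) ν :=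
  Integrable.of_bound ((by fun_prop : Measurable fun s : ℝ => s⁻¹ ^ 2).indicator
    measurableSet_Ioi).aestronglyMeasurable _ (Eventually.of_forall (norm_indicator_inv_sq_le ha))

theorem stronglyMeasurable_indicator_Iio_one (t : ℝ) :
    StronglyMeasurable ((Iio t).indicator (1 : ℝ → ℝ)) :=
  stronglyMeasurable_one.indicator measurableSet_Iio

theorem inversionMeasure_real_Iio (hν : ∀ᵐ s ∂ν, 0 < s) {t : ℝ} (ht : 0 ≤ t) :
    (inversionMeasure ν).real (Iio t) =
      ∫ s, (Ioi (1 + t)⁻¹).indicator (fun s => s⁻¹ ^ 2) s ∂ν := by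
  rw [← integral_indicator_one measurableSet_Iio,
    integral_inversionMeasure (stronglyMeasurable_indicator_Iio_one t)]
  exact integral_congr_ae (hν.mono fun s hs => inv_sq_smul_indicator_Iio hs ht)

theorem inversionMeasure_Iio_ne_top [IsFiniteMeasure ν] (hν : ∀ᵐ s ∂ν, 0 < s) {t : ℝ}
    (ht : 0 ≤ t) : inversionMeasure ν (Iio t) ≠ ⊤ := by
  have hint : Integrable ((Iio t).indicator (1 : ℝ → ℝ)) (inversionMeasure ν) :=
    (integrable_inversionMeasure_iff (stronglyMeasurable_indicator_Iio_one t)).2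
      ((integrable_indicator_inv_sq (inv_pos.2 (by linarith))).congr
        (hν.mono fun s hs => (inv_sq_smul_indicator_Iio hs ht).symm))
  have hon : IntegrableOn (fun _ => (1 : ℝ)) (Iio t) (inversionMeasure ν) :=
    (integrable_indicator_iff measurableSet_Iio).1 hint
  exact ((integrableOn_const_iff (by simp)).1 hon).resolve_left (by simp) |>.ne

end Inversion

section StieltjesMeasure

variable {μ : Measure ℝ}

theorem tendsto_measureReal_Iio (hμ : ∀ t, μ (Iio t) ≠ ⊤) (t : ℝ) :
    Tendsto (fun s => μ.real (Iio s)) (𝓝[>] t) (𝓝 (μ.real (Iic t))) := by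
  have hIic : ⋂ s > t, Iio s = Iic t := by
    ext s
    simp only [mem_iInter, mem_Iio, mem_Iic, gt_iff_lt]
    exact ⟨le_of_forall_gt, fun h r hr => h.trans_lt hr⟩
  have h := tendsto_measure_biInter_gt (μ := μ) (s := Iio) (a := t)
    (fun _ _ => measurableSet_Iio.nullMeasurableSet) (fun _ _ _ h => Iio_subset_Iio h)
    ⟨t + 1, by simp, hμ _⟩
  rw [hIic] at h
  have hfin : μ (Iic t) ≠ ⊤ := measure_ne_top_of_subset (Iic_subset_Iio.2 (lt_add_one t)) (hμ _)
  exact (ENNReal.tendsto_toReal hfin).comp h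

theorem stieltjesMeasure_eq_of_eq_measureReal_Iic {f : StieltjesFunction ℝ}
    (hμ : ∀ t, μ (Iic t) ≠ ⊤) (hf : ∀ t, f t = μ.real (Iic t)) : f.measure = μ := by
  refine Measure.ext_of_Ioc _ _ fun a b hab => ?_
  rw [StieltjesFunction.measure_Ioc, hf, hf, ← Iic_sdiff_Iic,
    measure_sdiff (Iic_subset_Iic.2 hab.le) measurableSet_Iic.nullMeasurableSet (hμ a),
    ENNReal.ofReal_sub _ measureReal_nonneg, ofReal_measureReal (hμ b), ofReal_measureReal (hμ a)]

theorem NondecreasingOp.measure_eq {E : Type*} [NormedAddCommGroup E] [InnerProductSpace ℂ E]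
    {G : ℝ → E →L[ℂ] E} (hG : NondecreasingOp G) (e : E)
    (hfin : ∀ t, 0 ≤ t → μ (Iio t) ≠ ⊤) (h0 : ∀ᵐ t ∂μ, 0 ≤ t)
    (hq : ∀ t, 0 ≤ t → (⟪e, G t e⟫_ℂ).re = μ.real (Iio t)) : hG.measure e = μ := by
  have hIio : ∀ t, μ (Iio (max t 0)) = μ (Iio t) := fun t =>
    measure_congr <| h0.mono fun s hs =>
      propext (lt_max_iff.trans (or_iff_left hs.not_gt))
  have hfin' : ∀ t, μ (Iio t) ≠ ⊤ := fun t => hIio t ▸ hfin _ (le_max_right _ _)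
  have hform : (fun t : ℝ => (⟪e, G (max t 0) e⟫_ℂ).re) = fun t => μ.real (Iio t) :=
    funext fun t => by rw [hq _ (le_max_right _ _), Measure.real, hIio, Measure.real]
  refine stieltjesMeasure_eq_of_eq_measureReal_Iic
    (fun t => measure_ne_top_of_subset (Iic_subset_Iio.2 (lt_add_one t)) (hfin' _)) fun t => ?_
  rw [Monotone.stieltjesFunction_eq]
  refine tendsto_nhds_unique ((hG.monotone e).tendsto_rightLim t) ?_
  rw [hform]
  exact tendsto_measureReal_Iio hfin' t

end StieltjesMeasure

section InverseIntegral

variable {ν : Measure ℝ} {v : ℝ}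

theorem lintegral_inv_le_of_lintegral_inv_add_le
    (h : ∀ ε : ℝ, 0 < ε → ∫⁻ s, (ENNReal.ofReal (s + ε))⁻¹ ∂ν ≤ ENNReal.ofReal v) :
    ∫⁻ s, (ENNReal.ofReal s)⁻¹ ∂ν ≤ ENNReal.ofReal v := by
  have hlim : ∀ s : ℝ, Tendsto (fun ε => (ENNReal.ofReal (s + ε))⁻¹) (𝓝[>] 0)
      (𝓝 (ENNReal.ofReal s)⁻¹) := fun s => by
    have hcont : Continuous fun ε : ℝ => (ENNReal.ofReal (s + ε))⁻¹ :=
      (ENNReal.continuous_ofReal.comp (continuous_const_add s)).inv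
    simpa using (hcont.tendsto 0).mono_left nhdsWithin_le_nhds
  have hle : ∀ᶠ ε in 𝓝[>] (0 : ℝ), ∫⁻ s, (ENNReal.ofReal (s + ε))⁻¹ ∂ν ≤ ENNReal.ofReal v :=
    eventually_mem_nhdsWithin.mono h
  calc ∫⁻ s, (ENNReal.ofReal s)⁻¹ ∂ν
      = ∫⁻ s, liminf (fun ε : ℝ => (ENNReal.ofReal (s + ε))⁻¹) (𝓝[>] (0 : ℝ)) ∂ν :=
        lintegral_congr fun s => (hlim s).liminf_eq.symm
    _ ≤ liminf (fun ε : ℝ => ∫⁻ s, (ENNReal.ofReal (s + ε))⁻¹ ∂ν) (𝓝[>] (0 : ℝ)) :=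
        lintegral_liminf_le fun ε => by fun_prop
    _ ≤ ENNReal.ofReal v := liminf_le_of_frequently_le' hle.frequently

theorem ae_pos_of_lintegral_inv_ne_top (h : ∫⁻ s, (ENNReal.ofReal s)⁻¹ ∂ν ≠ ⊤) :
    ∀ᵐ s ∂ν, 0 < s := by
  filter_upwards [ae_lt_top (by fun_prop) h] with s hs
  rwa [ENNReal.inv_lt_top, ENNReal.ofReal_pos] at hs

theorem ofReal_inv_ae_eq (h : ∀ᵐ s ∂ν, 0 < s) :
    (fun s : ℝ => ENNReal.ofReal s⁻¹) =ᵐ[ν] fun s => (ENNReal.ofReal s)⁻¹ :=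
  h.mono fun _ hs => ENNReal.ofReal_inv_of_pos hs

theorem integrable_inv_of_lintegral_inv_ne_top (h : ∫⁻ s, (ENNReal.ofReal s)⁻¹ ∂ν ≠ ⊤) :
    Integrable (fun s : ℝ => s⁻¹) ν := by
  have hpos := ae_pos_of_lintegral_inv_ne_top h
  refine ⟨(by fun_prop : Measurable fun s : ℝ => s⁻¹).aestronglyMeasurable, ?_⟩
  rw [hasFiniteIntegral_iff_ofReal (hpos.mono fun _ hs => (inv_pos.2 hs).le),
    lintegral_congr_ae (ofReal_inv_ae_eq hpos)]
  exact h.lt_top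

theorem integral_inv_le_of_lintegral_inv_le (hv : 0 ≤ v)
    (h : ∫⁻ s, (ENNReal.ofReal s)⁻¹ ∂ν ≤ ENNReal.ofReal v) : ∫ s, s⁻¹ ∂ν ≤ v := by
  have hpos := ae_pos_of_lintegral_inv_ne_top (ne_top_of_le_ne_top ENNReal.ofReal_ne_top h)
  rw [integral_eq_lintegral_of_nonneg_ae (hpos.mono fun _ hs => (inv_pos.2 hs).le)
    (by fun_prop : Measurable fun s : ℝ => s⁻¹).aestronglyMeasurable,
    lintegral_congr_ae (ofReal_inv_ae_eq hpos)]
  exact ENNReal.toReal_le_of_le_ofReal hv h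

theorem tendsto_integral_inv_add (hpos : ∀ᵐ s ∂ν, 0 < s)
    (hint : Integrable (fun s : ℝ => s⁻¹) ν) :
    Tendsto (fun ε : ℝ => ∫ s, (s + ε)⁻¹ ∂ν) (𝓝[>] 0) (𝓝 (∫ s, s⁻¹ ∂ν)) := by
  refine tendsto_integral_filter_of_dominated_convergence (fun s => s⁻¹)
    (Eventually.of_forall fun ε =>
      (by fun_prop : Measurable fun s : ℝ => (s + ε)⁻¹).aestronglyMeasurable) ?_ hint ?_
  · filter_upwards [self_mem_nhdsWithin] with ε (hε : 0 < ε)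
    filter_upwards [hpos] with s hs
    rw [Real.norm_of_nonneg (by positivity)]
    exact inv_anti₀ hs (by linarith)
  · filter_upwards [hpos] with s hs
    have hcont : ContinuousAt (fun ε : ℝ => (s + ε)⁻¹) 0 :=
      ContinuousAt.inv₀ (by fun_prop) (by simpa using hs.ne')
    simpa using hcont.tendsto.mono_left nhdsWithin_le_nhds

end InverseIntegral

section FormDomination

variable {H : Type*} [NormedAddCommGroup H] [InnerProductSpace ℂ H] [CompleteSpace H]
variable {C : H →L[ℂ] H} {x : H} {v : ℝ}

/-- The vector `x` is dominated by the form of `C ≥ 0`: it lies in the range of `√C`, and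
`‖C^(-1/2) x‖² ≤ v`. -/
def IsFormDominated (C : H →L[ℂ] H) (x : H) (v : ℝ) : Prop :=
  ∀ k : H, ‖⟪k, x⟫_ℂ‖ ^ 2 ≤ (⟪k, C k⟫_ℂ).re * v

theorem continuousOn_inv_add {S : Set ℝ} (hs : S ⊆ Ici 0) {ε : ℝ} (hε : 0 < ε) :
    ContinuousOn (fun s : ℝ => (s + ε)⁻¹) S :=
  (by fun_prop : Continuous fun s : ℝ => s + ε).continuousOn.inv₀ fun _ h =>
    (add_pos_of_nonneg_of_pos (hs h) hε).ne'

theorem apply_cfc_inv_add (hC : IsSelfAdjoint C) (hs : spectrum ℝ C ⊆ Ici 0) {ε : ℝ} (hε : 0 < ε)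
    (x : H) :
    C (cfc (fun s : ℝ => (s + ε)⁻¹) C x) + (ε : ℂ) • cfc (fun s : ℝ => (s + ε)⁻¹) C x = x := by
  have hne : ∀ s ∈ spectrum ℝ C, s + ε ≠ 0 := fun s h => (add_pos_of_nonneg_of_pos (hs h) hε).ne'
  have hadd : cfc (fun s : ℝ => s + ε) C = C + algebraMap ℝ _ ε := by
    rw [cfc_add_const ε (fun s => s) C, cfc_id' ℝ C]
  have hmul := Ring.mul_inverse_cancel _ (isUnit_cfc (fun s : ℝ => s + ε) C (by fun_prop) hC hne)
  rw [← cfc_inv _ C hne, hadd] at hmul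
  simpa using congrArg (fun M : H →L[ℂ] H => M x) hmul

theorem integral_inv_add_spectralMeasure_le (hC : IsSelfAdjoint C) (hs : spectrum ℝ C ⊆ Ici 0)
    (hv : 0 ≤ v) (hx : IsFormDominated C x v) {ε : ℝ} (hε : 0 < ε) :
    ∫ s, (s + ε)⁻¹ ∂(spectralMeasure hC x) ≤ v := by
  set r := ∫ s, (s + ε)⁻¹ ∂(spectralMeasure hC x)
  set k := cfc (fun s : ℝ => (s + ε)⁻¹) C x
  have hkx : ⟪k, x⟫_ℂ = r := by
    rw [← inner_conj_symm, inner_cfc_eq_integral hC x (continuousOn_inv_add hs hε),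
      Complex.conj_ofReal]
  have hdom : r ^ 2 ≤ (⟪k, C k⟫_ℂ).re * v := by
    simpa [hkx, Complex.norm_real] using hx k
  have hform : (⟪k, C k⟫_ℂ).re + ε * ‖k‖ ^ 2 = r := by
    have h := congrArg Complex.re hkx
    rw [← apply_cfc_inv_add hC hs hε x, inner_add_right, inner_smul_right, Complex.add_re,
      Complex.re_ofReal_mul, ← RCLike.re_eq_complex_re, inner_self_eq_norm_sq (𝕜 := ℂ)] at h
    exact h
  have hle : (⟪k, C k⟫_ℂ).re ≤ r := by nlinarith [sq_nonneg ‖k‖]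
  by_contra! hlt
  nlinarith

theorem lintegral_inv_spectralMeasure_le (hC : IsSelfAdjoint C) (hs : spectrum ℝ C ⊆ Ici 0)
    (hv : 0 ≤ v) (hx : IsFormDominated C x v) :
    ∫⁻ s, (ENNReal.ofReal s)⁻¹ ∂(spectralMeasure hC x) ≤ ENNReal.ofReal v := by
  refine lintegral_inv_le_of_lintegral_inv_add_le fun ε hε => ?_
  have hpos : ∀ᵐ s ∂(spectralMeasure hC x), 0 < s + ε := (ae_mem_spectrum hC x).mono fun s h =>
    add_pos_of_nonneg_of_pos (hs h) hε
  rw [← lintegral_congr_ae (hpos.mono fun s h => ENNReal.ofReal_inv_of_pos h),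
    ← ofReal_integral_eq_lintegral_ofReal
      (integrable_spectralMeasure hC x (continuousOn_inv_add hs hε))
      (hpos.mono fun s h => (inv_pos.2 h).le)]
  exact ENNReal.ofReal_le_ofReal (integral_inv_add_spectralMeasure_le hC hs hv hx hε)

theorem lintegral_inv_spectralMeasure_ne_top (hC : IsSelfAdjoint C) (hs : spectrum ℝ C ⊆ Ici 0)
    (hv : 0 ≤ v) (hx : IsFormDominated C x v) :
    ∫⁻ s, (ENNReal.ofReal s)⁻¹ ∂(spectralMeasure hC x) ≠ ⊤ :=
  ne_top_of_le_ne_top ENNReal.ofReal_ne_top (lintegral_inv_spectralMeasure_le hC hs hv hx)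

end FormDomination

section Cutoff

/-- Continuous functions of `s` that tend to the indicator function of `(a, ∞)` times `s⁻²` as
`n → ∞`, boundedly. -/
noncomputable def cutoff (a : ℝ) (n : ℕ) (s : ℝ) : ℝ :=
  min 1 (n * max (s - a) 0) * (max s a)⁻¹ ^ 2

theorem continuous_cutoff {a : ℝ} (ha : 0 < a) (n : ℕ) : Continuous (cutoff a n) := by
  have : Continuous fun s : ℝ => (max s a)⁻¹ :=
    (continuous_id.max continuous_const).inv₀ fun s => (lt_max_of_lt_right ha).ne'
  unfold cutoff
  fun_prop

theorem norm_cutoff_le {a : ℝ} (ha : 0 < a) (n : ℕ) (s : ℝ) : ‖cutoff a n s‖ ≤ a⁻¹ ^ 2 := by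
  have : 0 ≤ min 1 ((n : ℝ) * max (s - a) 0) := le_min zero_le_one (by positivity)
  have : 0 < max s a := lt_max_of_lt_right ha
  rw [cutoff, Real.norm_of_nonneg (by positivity)]
  calc _ ≤ 1 * a⁻¹ ^ 2 := by
        gcongr
        · exact min_le_left _ _
        · exact le_max_right _ _
    _ = _ := one_mul _

theorem tendsto_cutoff (a s : ℝ) :
    Tendsto (fun n => cutoff a n s) atTop (𝓝 ((Ioi a).indicator (fun s => s⁻¹ ^ 2) s)) := by
  rcases lt_or_ge a s with h | h
  · have hlarge : Tendsto (fun n : ℕ => (n : ℝ) * (s - a)) atTop atTop :=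
      tendsto_natCast_atTop_atTop.atTop_mul_const (sub_pos.2 h)
    refine tendsto_const_nhds.congr' ?_
    filter_upwards [hlarge.eventually_ge_atTop 1] with n hn
    rw [indicator_of_mem (mem_Ioi.2 h), cutoff, max_eq_left (sub_pos.2 h).le, max_eq_left h.le,
      min_eq_left hn, one_mul]
  · simp [cutoff, h.not_gt, max_eq_right (sub_nonpos.2 h)]

theorem tendsto_integral_cutoff {ν : Measure ℝ} [IsFiniteMeasure ν] {a : ℝ} (ha : 0 < a) :
    Tendsto (fun n => ∫ s, cutoff a n s ∂ν) atTop
      (𝓝 (∫ s, (Ioi a).indicator (fun s => s⁻¹ ^ 2) s ∂ν)) :=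
  tendsto_integral_of_dominated_convergence (fun _ => a⁻¹ ^ 2)
    (fun n => (continuous_cutoff ha n).aestronglyMeasurable) (integrable_const _)
    (fun n => Eventually.of_forall (norm_cutoff_le ha n)) (Eventually.of_forall (tendsto_cutoff a))

end Cutoff

section TransferFunction

variable {H : Type*} [NormedAddCommGroup H] [InnerProductSpace ℂ H] [CompleteSpace H]
variable {E : Type*} [NormedAddCommGroup E] [InnerProductSpace ℂ E] [CompleteSpace E]
variable {C : H →L[ℂ] H} {F : E →L[ℂ] H} {V₀ : E →L[ℂ] E}

/-- The function `z ↦ V₀ + (z + 1) F* (1 - (z + 1) C)⁻¹ F`. When `C = (B + 1)⁻¹`, `F = (B + 1)⁻¹ K`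
and `V₀ = K* (B + 1)⁻¹ K`, its value at `z` is `K* (B - z)⁻¹ K`, expanded about `-1` by the
resolvent identity. -/
noncomputable def transferFunction (C : H →L[ℂ] H) (F : E →L[ℂ] H) (V₀ : E →L[ℂ] E) (z : ℂ) :
    E →L[ℂ] E :=
  V₀ + (z + 1) • ContinuousLinearMap.adjoint F ∘L Ring.inverse (1 - (z + 1) • C) ∘L F

theorem inner_transferFunction (hC : IsSelfAdjoint C) {z : ℂ} (hz : z.im ≠ 0) (e : E) :
    ⟪e, transferFunction C F V₀ z e⟫_ℂ = ⟪e, V₀ e⟫_ℂ +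
      (z + 1) * ∫ s : ℝ, (1 - (z + 1) * s)⁻¹ ∂(spectralMeasure hC (F e)) := by
  rw [← inner_inverse_one_sub_smul_eq_integral hC (F e) (by simpa using hz)]
  simp [transferFunction, inner_add_right, inner_smul_right,
    ContinuousLinearMap.adjoint_inner_right]

theorem differentiableAt_transferFunction (hC : IsSelfAdjoint C) {z : ℂ} (hz : z.im ≠ 0) :
    DifferentiableAt ℂ (transferFunction C F V₀) z := by
  have hunit : IsUnit (1 - (z + 1) • C) := isUnit_one_sub_smul hC (by simpa using hz)
  have : DifferentiableAt ℂ (fun z : ℂ => Ring.inverse (1 - (z + 1) • C)) z :=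
    DifferentiableAt.comp (g := Ring.inverse) z (differentiableAt_inverse hunit) (by fun_prop)
  unfold transferFunction
  fun_prop

theorem inner_adjoint_comp_cfc_comp (hC : IsSelfAdjoint C) {φ : ℝ → ℝ}
    (hφ : ContinuousOn φ (spectrum ℝ C)) (e : E) :
    ⟪e, (ContinuousLinearMap.adjoint F ∘L cfc φ C ∘L F) e⟫_ℂ =
      ∫ s, φ s ∂(spectralMeasure hC (F e)) := by
  rw [← inner_cfc_eq_integral hC (F e) hφ]
  exact ContinuousLinearMap.adjoint_inner_right F e _

theorem ae_spectralMeasure_mem_Ioc (hC : IsSelfAdjoint C) (hs : spectrum ℝ C ⊆ Icc 0 1) {x : H}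
    {v : ℝ} (hv : 0 ≤ v) (hx : IsFormDominated C x v) :
    ∀ᵐ s ∂(spectralMeasure hC x), s ∈ Ioc (0 : ℝ) 1 := by
  have hfin := lintegral_inv_spectralMeasure_ne_top hC (hs.trans Icc_subset_Ici_self) hv hx
  filter_upwards [ae_pos_of_lintegral_inv_ne_top hfin, ae_mem_spectrum hC x] with s hpos hmem
  exact ⟨hpos, (hs hmem).2⟩

end TransferFunction

section InversionIntegrals

variable {ν : Measure ℝ}

theorem integrable_one_div_one_add_inversionMeasure (hν : ∀ᵐ s ∂ν, 0 < s)
    (hint : Integrable (fun s : ℝ => s⁻¹) ν) :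
    Integrable (fun t : ℝ => 1 / (1 + t)) (inversionMeasure ν) := by
  refine (integrable_inversionMeasure_iff (by fun_prop : Measurable _).stronglyMeasurable).2
    (hint.congr ?_)
  filter_upwards [hν] with s hs
  have := hs.ne'
  simp only [smul_eq_mul]
  field_simp
  ring

theorem inv_sq_smul_one_div_sub {z : ℂ} (hz : z.im ≠ 0) {s : ℝ} (hs : s ≠ 0) :
    s⁻¹ ^ 2 • (1 / (((s⁻¹ - 1 : ℝ) : ℂ) - z)) =
      (z + 1) * (1 - (z + 1) * s)⁻¹ + ((s⁻¹ : ℝ) : ℂ) := by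
  have hden : 1 - (z + 1) * s ≠ 0 := one_sub_mul_ne_zero (by simpa using hz) s
  have hs' : (s : ℂ) ≠ 0 := by exact_mod_cast hs
  have hsub : ((s⁻¹ - 1 : ℝ) : ℂ) - z = (1 - (z + 1) * s) / s := by
    push_cast
    field_simp
    ring
  obtain ⟨w, hw⟩ : ∃ w, 1 - (z + 1) * s = w := ⟨_, rfl⟩
  have hz' : z + 1 = (1 - w) / s := by
    rw [← hw]
    field_simp
    ring
  rw [hsub, hw, hz', Complex.real_smul]
  rw [hw] at hden
  push_cast
  field_simp
  ring

theorem integral_one_div_sub_inversionMeasure [IsFiniteMeasure ν]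
    (hν : ∀ᵐ s ∂ν, s ∈ Ioc (0 : ℝ) 1) (hint : Integrable (fun s : ℝ => s⁻¹) ν) {z : ℂ}
    (hz : z.im ≠ 0) :
    ∫ t : ℝ, 1 / ((t : ℂ) - z) ∂(inversionMeasure ν) =
      (z + 1) * ∫ s : ℝ, (1 - (z + 1) * s)⁻¹ ∂ν + (∫ s, s⁻¹ ∂ν : ℝ) := by
  have hres : Integrable (fun s : ℝ => (1 - (z + 1) * s)⁻¹) ν := by
    have hcont : Continuous fun s : ℝ => (1 - (z + 1) * s)⁻¹ :=
      (by fun_prop : Continuous fun s : ℝ => 1 - (z + 1) * s).inv₀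
        (one_sub_mul_ne_zero (by simpa using hz))
    have hIcc := hcont.continuousOn.integrableOn_compact (μ := ν) (isCompact_Icc (a := 0) (b := 1))
    rwa [IntegrableOn, Measure.restrict_eq_self_of_ae_mem
      (hν.mono fun s hs => Ioc_subset_Icc_self hs)] at hIcc
  have hinv : Integrable (fun s : ℝ => ((s⁻¹ : ℝ) : ℂ)) ν := hint.ofReal
  rw [integral_inversionMeasure (by fun_prop : Measurable _).stronglyMeasurable,
    integral_congr_ae (hν.mono fun s hs => inv_sq_smul_one_div_sub hz hs.1.ne'),
    integral_add (hres.const_mul _) hinv, integral_const_mul, integral_complex_ofReal]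

end InversionIntegrals

section StieltjesRepresentation

variable {H : Type*} [NormedAddCommGroup H] [InnerProductSpace ℂ H] [CompleteSpace H]
variable {E : Type*} [NormedAddCommGroup E] [InnerProductSpace ℂ E]
variable {C : H →L[ℂ] H} {F : E →L[ℂ] H} {V₀ : E →L[ℂ] E}

theorem exists_inner_eq_integral_indicator_inv_sq [FiniteDimensional ℂ E] (hC : IsSelfAdjoint C)
    (F : E →L[ℂ] H) {a : ℝ} (ha : 0 < a) :
    ∃ N : E →L[ℂ] E, ∀ e, ⟪e, N e⟫_ℂ =
      (∫ s, (Ioi a).indicator (fun s => s⁻¹ ^ 2) s ∂(spectralMeasure hC (F e)) : ℝ) := by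
  have : CompleteSpace E := FiniteDimensional.complete ℂ E
  refine exists_inner_map_eq_of_tendsto (l := atTop)
    (M := fun n => ContinuousLinearMap.adjoint F ∘L cfc (cutoff a n) C ∘L F) fun e => ?_
  simp only [inner_adjoint_comp_cfc_comp hC (continuous_cutoff ha _).continuousOn]
  exact (Complex.continuous_ofReal.tendsto _).comp (tendsto_integral_cutoff ha)

theorem exists_isPositive_inner_eq_sub_integral_inv [FiniteDimensional ℂ E] (hC : IsSelfAdjoint C)
    (hs : spectrum ℝ C ⊆ Ici 0) (hV₀ : V₀.IsPositive)
    (hF : ∀ e, IsFormDominated C (F e) (⟪e, V₀ e⟫_ℂ).re) :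
    ∃ γ : E →L[ℂ] E, γ.IsPositive ∧
      ∀ e, ⟪e, γ e⟫_ℂ = ⟪e, V₀ e⟫_ℂ - (∫ s, s⁻¹ ∂(spectralMeasure hC (F e)) : ℝ) := by
  have : CompleteSpace E := FiniteDimensional.complete ℂ E
  have hle := fun e =>
    lintegral_inv_spectralMeasure_le hC hs (hV₀.re_inner_nonneg_right e) (hF e)
  have hfin := fun e => ne_top_of_le_ne_top ENNReal.ofReal_ne_top (hle e)
  have hreal : ∀ e, ((⟪e, V₀ e⟫_ℂ).re : ℂ) = ⟪e, V₀ e⟫_ℂ :=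
    fun e => hV₀.isSymmetric.coe_re_inner_self_apply e
  obtain ⟨γ, hγ⟩ : ∃ γ : E →L[ℂ] E,
      ∀ e, ⟪e, γ e⟫_ℂ = ⟪e, V₀ e⟫_ℂ - (∫ s, s⁻¹ ∂(spectralMeasure hC (F e)) : ℝ) := by
    refine exists_inner_map_eq_of_tendsto (l := 𝓝[>] (0 : ℝ)) (M := fun ε =>
      V₀ - ContinuousLinearMap.adjoint F ∘L cfc (fun s : ℝ => (s + ε)⁻¹) C ∘L F) fun e => ?_
    have hlim := tendsto_integral_inv_add (ae_pos_of_lintegral_inv_ne_top (hfin e))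
      (integrable_inv_of_lintegral_inv_ne_top (hfin e))
    refine (((Complex.continuous_ofReal.tendsto _).comp hlim).const_sub _).congr' ?_
    filter_upwards [self_mem_nhdsWithin] with ε hε
    rw [sub_apply, inner_sub_right,
      inner_adjoint_comp_cfc_comp hC (continuousOn_inv_add hs hε), Function.comp_apply]
  refine ⟨γ, isPositive_of_inner_eq_ofReal
    (q := fun e => (⟪e, V₀ e⟫_ℂ).re - ∫ s, s⁻¹ ∂(spectralMeasure hC (F e)))
    (fun e => ?_) fun e => ?_, hγ⟩
  · rw [hγ, Complex.ofReal_sub, hreal]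
  · exact sub_nonneg.2
      (integral_inv_le_of_lintegral_inv_le (hV₀.re_inner_nonneg_right e) (hle e))

theorem exists_nondecreasingOp_measure_eq_inversionMeasure [FiniteDimensional ℂ E]
    (hC : IsSelfAdjoint C) (hpos : ∀ e, ∀ᵐ s ∂(spectralMeasure hC (F e)), s ∈ Ioc (0 : ℝ) 1) :
    ∃ (G : ℝ → E →L[ℂ] E) (hG : NondecreasingOp G),
      ∀ e, hG.measure e = inversionMeasure (spectralMeasure hC (F e)) := by
  have : CompleteSpace E := FiniteDimensional.complete ℂ E
  have hpos' : ∀ e, ∀ᵐ s ∂(spectralMeasure hC (F e)), 0 < s := fun e =>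
    (hpos e).mono fun _ hs => hs.1
  have hex : ∀ t : ℝ, ∃ N : E →L[ℂ] E, 0 ≤ t →
      ∀ e, ⟪e, N e⟫_ℂ = (inversionMeasure (spectralMeasure hC (F e))).real (Iio t) := fun t => by
    rcases lt_or_ge t 0 with ht | ht
    · exact ⟨0, fun h => absurd h ht.not_ge⟩
    · obtain ⟨N, hN⟩ := exists_inner_eq_integral_indicator_inv_sq hC F
        (inv_pos.2 (by linarith : 0 < 1 + t))
      exact ⟨N, fun _ e => by rw [hN, inversionMeasure_real_Iio (hpos' e) ht]⟩
  choose G hG using hex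
  have hmono : NondecreasingOp G := fun s t hs hst => by
    have ht := hs.trans hst
    refine isPositive_of_inner_eq_ofReal
      (q := fun e => (inversionMeasure (spectralMeasure hC (F e))).real (Iio t) -
        (inversionMeasure (spectralMeasure hC (F e))).real (Iio s)) (fun e => ?_) fun e => ?_
    · rw [sub_apply, inner_sub_right, hG t ht, hG s hs, Complex.ofReal_sub]
    · exact sub_nonneg.2
        (measureReal_mono (Iio_subset_Iio hst) (inversionMeasure_Iio_ne_top (hpos' e) ht))
  exact ⟨G, hmono, fun e => hmono.measure_eq e
    (fun t ht => inversionMeasure_Iio_ne_top (hpos' e) ht) (ae_inversionMeasure_nonneg (hpos e))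
    fun t ht => by rw [hG t ht, Complex.ofReal_re]⟩

theorem exists_stieltjes_representation_transferFunction [CompleteSpace E] [FiniteDimensional ℂ E]
    (hC : IsSelfAdjoint C) (hs : spectrum ℝ C ⊆ Icc 0 1) (hV₀ : V₀.IsPositive)
    (hF : ∀ e, IsFormDominated C (F e) (⟪e, V₀ e⟫_ℂ).re) :
    ∃ (γ : E →L[ℂ] E) (G : ℝ → E →L[ℂ] E) (hG : NondecreasingOp G), γ.IsPositive ∧
      (∀ e, IntegrableOn (fun t : ℝ => 1 / (1 + t)) (Ici 0) (hG.measure e)) ∧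
      ∀ z : ℂ, z.im ≠ 0 → ∀ e, ⟪e, transferFunction C F V₀ z e⟫_ℂ =
        ⟪e, γ e⟫_ℂ + ∫ t in Ici (0 : ℝ), 1 / ((t : ℂ) - z) ∂(hG.measure e) := by
  have hs0 := hs.trans Icc_subset_Ici_self
  have hIoc := fun e => ae_spectralMeasure_mem_Ioc hC hs (hV₀.re_inner_nonneg_right e) (hF e)
  have hint := fun e => integrable_inv_of_lintegral_inv_ne_top
    (lintegral_inv_spectralMeasure_ne_top hC hs0 (hV₀.re_inner_nonneg_right e) (hF e))
  obtain ⟨γ, hγpos, hγ⟩ := exists_isPositive_inner_eq_sub_integral_inv hC hs0 hV₀ hF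
  obtain ⟨G, hG, hμ⟩ := exists_nondecreasingOp_measure_eq_inversionMeasure hC hIoc
  have hrestrict : ∀ e, (hG.measure e).restrict (Ici 0) =
      inversionMeasure (spectralMeasure hC (F e)) := fun e => by
    rw [hμ]
    exact Measure.restrict_eq_self_of_ae_mem (ae_inversionMeasure_nonneg (hIoc e))
  refine ⟨γ, G, hG, hγpos, fun e => ?_, fun z hz e => ?_⟩
  · rw [IntegrableOn, hrestrict]
    exact integrable_one_div_one_add_inversionMeasure ((hIoc e).mono fun _ hs => hs.1) (hint e)
  · rw [inner_transferFunction hC hz, hrestrict, hγ,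
      integral_one_div_sub_inversionMeasure (hIoc e) (hint e) hz]
    ring

end StieltjesRepresentation

section GridSums

/-- The `j`-th cell of the partition of `[0, ∞)` of mesh `1 / (n + 1)`; the zeroth cell
`(-1 / (n + 1), 0]` catches the point `0`. -/
abbrev gridCell (n j : ℕ) : Set ℝ :=
  Ioc (((j : ℝ) - 1) / ((n : ℝ) + 1)) ((j : ℝ) / ((n : ℝ) + 1))

theorem mem_gridCell_iff {t : ℝ} (ht : 0 ≤ t) (n j : ℕ) :
    t ∈ gridCell n j ↔ ⌈t * ((n : ℝ) + 1)⌉₊ = j := by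
  have hn : (0 : ℝ) < (n : ℝ) + 1 := by positivity
  rw [gridCell, mem_Ioc, div_lt_iff₀ hn, le_div_iff₀ hn]
  cases j with
  | zero =>
    have : 0 ≤ t * ((n : ℝ) + 1) := by positivity
    rw [Nat.ceil_eq_zero, Nat.cast_zero]
    exact ⟨fun h => h.2, fun h => ⟨by linarith, h⟩⟩
  | succ j =>
    rw [Nat.ceil_eq_iff (Nat.succ_ne_zero j)]
    simp

variable {G : Type*} [NormedAddCommGroup G] {f : ℝ → G} {t : ℝ}

/-- The step function on `[0, n + 1)` that takes on each cell of mesh `1 / (n + 1)` the value of `f`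
at its right end. -/
noncomputable def gridStep (f : ℝ → G) (n : ℕ) (t : ℝ) : G :=
  ∑ j ∈ Finset.range ((n + 1) * (n + 1)),
    (gridCell n j).indicator (fun _ => f ((j : ℝ) / ((n : ℝ) + 1))) t

theorem gridStep_eq (f : ℝ → G) (n : ℕ) (ht : 0 ≤ t) :
    gridStep f n t = if ⌈t * ((n : ℝ) + 1)⌉₊ < (n + 1) * (n + 1) then
      f (⌈t * ((n : ℝ) + 1)⌉₊ / ((n : ℝ) + 1)) else 0 := by
  simp only [gridStep, indicator_apply, mem_gridCell_iff ht, Finset.sum_ite_eq, Finset.mem_range]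

theorem norm_gridStep_le {c : ℝ} (ht : 0 ≤ t) (hf : ∀ τ, t ≤ τ → ‖f τ‖ ≤ c) (n : ℕ) :
    ‖gridStep f n t‖ ≤ c := by
  rw [gridStep_eq f n ht]
  split_ifs
  · exact hf _ ((le_div_iff₀ (by positivity)).2 (Nat.le_ceil _))
  · exact norm_zero.trans_le ((norm_nonneg _).trans (hf t le_rfl))

theorem tendsto_gridStep (ht : 0 ≤ t) (hf : ContinuousAt f t) :
    Tendsto (fun n => gridStep f n t) atTop (𝓝 (f t)) := by
  have hN : Tendsto (fun n : ℕ => (n : ℝ) + 1) atTop atTop :=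
    tendsto_atTop_add_const_right _ _ tendsto_natCast_atTop_atTop
  have hgrid : Tendsto (fun n : ℕ => (⌈t * ((n : ℝ) + 1)⌉₊ : ℝ) / ((n : ℝ) + 1)) atTop (𝓝 t) :=
    (tendsto_nat_ceil_mul_div_atTop ht).comp hN
  refine (hf.tendsto.comp hgrid).congr' ?_
  filter_upwards [hgrid.eventually_lt_const (lt_add_one t), hN.eventually_ge_atTop (t + 1)]
    with n hlt hn
  rw [div_lt_iff₀ (by positivity)] at hlt
  have hrange : ⌈t * ((n : ℝ) + 1)⌉₊ < (n + 1) * (n + 1) := by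
    rw [← Nat.cast_lt (α := ℝ)]
    push_cast
    nlinarith
  rw [gridStep_eq f n ht, if_pos hrange, Function.comp_apply]

variable [NormedSpace ℝ G] [CompleteSpace G] {μ : Measure ℝ} [IsLocallyFiniteMeasure μ]

theorem integral_gridStep (f : ℝ → G) (n : ℕ) :
    ∫ t, gridStep f n t ∂μ = ∑ j ∈ Finset.range ((n + 1) * (n + 1)),
      μ.real (gridCell n j) • f ((j : ℝ) / ((n : ℝ) + 1)) := by
  simp only [gridStep]
  rw [integral_finsetSum _ fun j _ => (integrable_indicator_iff measurableSet_Ioc).2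
    (integrableOn_const measure_Ioc_lt_top.ne)]
  refine Finset.sum_congr rfl fun j _ => ?_
  rw [integral_indicator measurableSet_Ioc, setIntegral_const]

theorem tendsto_sum_measureReal_gridCell_smul (hμ : ∀ᵐ t ∂μ, 0 ≤ t) {g : ℝ → ℝ}
    (hg : Integrable g μ) (hf : Continuous f)
    (hfg : ∀ t, 0 ≤ t → ∀ τ, t ≤ τ → ‖f τ‖ ≤ g t) :
    Tendsto (fun n : ℕ => ∑ j ∈ Finset.range ((n + 1) * (n + 1)),
      μ.real (gridCell n j) • f ((j : ℝ) / ((n : ℝ) + 1))) atTop (𝓝 (∫ t, f t ∂μ)) := by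
  simp only [← integral_gridStep]
  refine tendsto_integral_of_dominated_convergence g (fun n => ?_) hg
    (fun n => hμ.mono fun t ht => norm_gridStep_le ht (hfg t ht) n)
    (hμ.mono fun t ht => tendsto_gridStep ht hf.continuousAt)
  exact (Finset.stronglyMeasurable_fun_sum _ fun j _ =>
    stronglyMeasurable_const.indicator measurableSet_Ioc).aestronglyMeasurable

end GridSums

section OperatorIncrements

variable {E : Type*} [NormedAddCommGroup E] [InnerProductSpace ℂ E] {G : ℝ → E →L[ℂ] E}

theorem NondecreasingOp.stieltjesFunction_of_neg (hG : NondecreasingOp G) (e : E) {t : ℝ}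
    (ht : t < 0) : (hG.monotone e).stieltjesFunction t = (⟪e, G 0 e⟫_ℂ).re := by
  rw [Monotone.stieltjesFunction_eq]
  refine rightLim_eq_of_tendsto (tendsto_const_nhds.congr' ?_)
  filter_upwards [nhdsWithin_le_nhds (Iio_mem_nhds ht)] with s hs
  rw [max_eq_right (le_of_lt hs)]

theorem NondecreasingOp.ae_measure_nonneg (hG : NondecreasingOp G) (e : E) :
    ∀ᵐ t ∂(hG.measure e), 0 ≤ t := by
  have hbot : Tendsto (hG.monotone e).stieltjesFunction atBot (𝓝 (⟪e, G 0 e⟫_ℂ).re) :=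
    tendsto_const_nhds.congr' ((eventually_lt_atBot 0).mono fun t ht =>
      (hG.stieltjesFunction_of_neg e ht).symm)
  have hleft : Function.leftLim (hG.monotone e).stieltjesFunction 0 = (⟪e, G 0 e⟫_ℂ).re :=
    leftLim_eq_of_tendsto (tendsto_const_nhds.congr' (eventually_mem_nhdsWithin.mono fun t ht =>
      (hG.stieltjesFunction_of_neg e ht).symm))
  have hzero : hG.measure e (Iio 0) = 0 := by
    rw [NondecreasingOp.measure, StieltjesFunction.measure_Iio _ hbot, hleft, sub_self,
      ENNReal.ofReal_zero]
  exact (measure_eq_zero_iff_ae_notMem.1 hzero).mono fun t ht => not_lt.1 ht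

theorem NondecreasingOp.exists_inner_eq_stieltjesFunction_sub [FiniteDimensional ℂ E]
    (hG : NondecreasingOp G) (t : ℝ) : ∃ N : E →L[ℂ] E, ∀ e,
      ⟪e, N e⟫_ℂ = ((hG.monotone e).stieltjesFunction t - (⟪e, G 0 e⟫_ℂ).re : ℝ) := by
  refine exists_inner_map_eq_of_tendsto (l := 𝓝[>] t) (M := fun s => G (max s 0) - G 0) fun e => ?_
  rw [Monotone.stieltjesFunction_eq]
  refine ((Complex.continuous_ofReal.tendsto _).comp
    (((hG.monotone e).tendsto_rightLim t).sub_const _)).congr fun s => ?_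
  have hpos := hG 0 (max s 0) le_rfl (le_max_right _ _)
  have hreal := hpos.isSymmetric.coe_re_inner_self_apply e
  rw [Function.comp_apply, ← Complex.sub_re, ← inner_sub_right, ← sub_apply]
  exact hreal

theorem NondecreasingOp.exists_isPositive_inner_eq_measureReal_Ioc [FiniteDimensional ℂ E]
    (hG : NondecreasingOp G) {a b : ℝ} (hab : a ≤ b) :
    ∃ D : E →L[ℂ] E, D.IsPositive ∧ ∀ e, ⟪e, D e⟫_ℂ = (hG.measure e).real (Ioc a b) := by
  obtain ⟨N, hN⟩ := hG.exists_inner_eq_stieltjesFunction_sub a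
  obtain ⟨N', hN'⟩ := hG.exists_inner_eq_stieltjesFunction_sub b
  have hD : ∀ e, ⟪e, (N' - N) e⟫_ℂ = (hG.measure e).real (Ioc a b) := fun e => by
    rw [Measure.real, NondecreasingOp.measure, StieltjesFunction.measure_Ioc,
      ENNReal.toReal_ofReal (sub_nonneg.2 ((hG.monotone e).stieltjesFunction.mono hab)),
      sub_apply, inner_sub_right, hN, hN', ← Complex.ofReal_sub, sub_sub_sub_cancel_right]
  exact ⟨N' - N, isPositive_of_inner_eq_ofReal hD fun e => measureReal_nonneg, hD⟩

end OperatorIncrements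

section StieltjesKernel

variable {E : Type*} [NormedAddCommGroup E] [InnerProductSpace ℂ E]

/-- The kernel `(z V(z) - w̄ V(w)*) / (z - w̄)` of an operator function is non-negative on
`ℂ \ ℝ`, wherever no denominator vanishes. -/
def KernelNonneg (V : ℂ → E →L[ℂ] E) : Prop :=
  ∀ (n : ℕ) (z : Fin n → ℂ) (e : Fin n → E), (∀ k, (z k).im ≠ 0) →
    (∀ k l, z k ≠ conj (z l)) →
    0 ≤ (∑ k, ∑ l, (z k * ⟪e l, V (z k) (e k)⟫_ℂ - conj (z l) * ⟪V (z l) (e l), e k⟫_ℂ) /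
      (z k - conj (z l))).re

theorem KernelNonneg.add {V W : ℂ → E →L[ℂ] E} (hV : KernelNonneg V) (hW : KernelNonneg W) :
    KernelNonneg fun z => V z + W z := by
  intro n z e hz hzz
  refine (add_nonneg (hV n z e hz hzz) (hW n z e hz hzz)).trans_eq ?_
  simp only [← Complex.add_re, ← Finset.sum_add_distrib]
  refine congrArg Complex.re
    (Finset.sum_congr rfl fun k _ => Finset.sum_congr rfl fun l _ => ?_)
  rw [← add_div, add_apply, add_apply, inner_add_left, inner_add_right]
  ring

theorem KernelNonneg.sum {ι : Type*} (s : Finset ι) {V : ι → ℂ → E →L[ℂ] E}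
    (hV : ∀ i ∈ s, KernelNonneg (V i)) : KernelNonneg fun z => ∑ i ∈ s, V i z := by
  classical
  induction s using Finset.induction_on with
  | empty => intro n z e _ _; simp
  | insert i s hi ih =>
    simp only [Finset.sum_insert hi]
    exact (hV i (Finset.mem_insert_self _ _)).add
      (ih fun j hj => hV j (Finset.mem_insert_of_mem hj))

theorem inner_sum_map_sum {n : ℕ} {D : E →L[ℂ] E} (x : Fin n → E) :
    ⟪∑ l, x l, D (∑ k, x k)⟫_ℂ = ∑ k, ∑ l, ⟪x l, D (x k)⟫_ℂ := by
  simp only [map_sum, inner_sum, sum_inner]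

theorem KernelNonneg.const {γ : E →L[ℂ] E} (hγ : γ.IsPositive) : KernelNonneg fun _ => γ := by
  intro n z e _ hzz
  have h : 0 ≤ (⟪∑ k, e k, γ (∑ k, e k)⟫_ℂ).re := hγ.re_inner_nonneg_right _
  rw [inner_sum_map_sum] at h
  refine h.trans_eq (congrArg Complex.re
    (Finset.sum_congr rfl fun k _ => Finset.sum_congr rfl fun l _ => ?_))
  rw [hγ.inner_left_eq_inner_right, ← sub_mul,
    mul_div_cancel_left₀ _ (sub_ne_zero.2 (hzz k l))]

theorem ofReal_sub_ne_zero {z : ℂ} (hz : z.im ≠ 0) (t : ℝ) : (t : ℂ) - z ≠ 0 := fun h => by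
  simpa [hz] using congrArg Complex.im h

theorem KernelNonneg.inv_sub_smul {D : E →L[ℂ] E} (hD : D.IsPositive) {t : ℝ} (ht : 0 ≤ t) :
    KernelNonneg fun z => (1 / ((t : ℂ) - z)) • D := by
  intro n z e hz hzz
  have h := mul_nonneg ht (hD.re_inner_nonneg_right (∑ k, (1 / ((t : ℂ) - z k)) • e k))
  change 0 ≤ t * Complex.re _ at h
  rw [inner_sum_map_sum, ← Complex.re_ofReal_mul] at h
  simp only [Finset.mul_sum] at h
  refine h.trans_eq (congrArg Complex.re
    (Finset.sum_congr rfl fun k _ => Finset.sum_congr rfl fun l _ => ?_))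
  have hk := ofReal_sub_ne_zero (hz k) t
  have hl : (t : ℂ) - conj (z l) ≠ 0 := ofReal_sub_ne_zero (by simpa using hz l) t
  have hkl := sub_ne_zero.2 (hzz k l)
  simp only [smul_apply, map_smul, inner_smul_right, inner_smul_left,
    hD.inner_left_eq_inner_right, map_div₀, map_one, map_sub, Complex.conj_ofReal]
  field_simp
  ring

theorem KernelNonneg.of_tendsto {α : Type*} {l : Filter α} [l.NeBot] {V : α → ℂ → E →L[ℂ] E}
    {W : ℂ → E →L[ℂ] E} (hV : ∀ a, KernelNonneg (V a))
    (h : ∀ z : ℂ, z.im ≠ 0 → ∀ e, Tendsto (fun a => ⟪e, V a z e⟫_ℂ) l (𝓝 ⟪e, W z e⟫_ℂ)) :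
    KernelNonneg W := by
  intro n z e hz hzz
  have hright : ∀ k x y, Tendsto (fun a => ⟪x, V a (z k) y⟫_ℂ) l (𝓝 ⟪x, W (z k) y⟫_ℂ) :=
    fun k => tendsto_inner_map_of_quadratic (h (z k) (hz k))
  have hleft : ∀ k x y, Tendsto (fun a => ⟪V a (z k) x, y⟫_ℂ) l (𝓝 ⟪W (z k) x, y⟫_ℂ) :=
    fun k x y => by
      simpa only [Function.comp_def, inner_conj_symm] using
        (Complex.continuous_conj.tendsto _).comp (hright k y x)
  refine ge_of_tendsto' ((Complex.continuous_re.tendsto _).comp (tendsto_finsetSum _ fun k _ =>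
    tendsto_finsetSum _ fun l _ => (((hright k (e l) (e k)).const_mul (z k)).sub
      ((hleft l (e l) (e k)).const_mul (conj (z l)))).div_const (z k - conj (z l))))
    fun a => hV a n z e hz hzz

theorem norm_one_div_ofReal_sub_le {z : ℂ} (hz : z.im ≠ 0) {t τ : ℝ} (ht : 0 ≤ t) (h : t ≤ τ) :
    ‖1 / ((τ : ℂ) - z)‖ ≤ (1 + ‖1 + z‖ / |z.im|) * (1 / (1 + t)) := by
  have hpos : 0 < ‖(τ : ℂ) - z‖ := norm_pos_iff.2 (ofReal_sub_ne_zero hz τ)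
  have him : |z.im| ≤ ‖(τ : ℂ) - z‖ := by
    simpa using Complex.abs_im_le_norm ((τ : ℂ) - z)
  have htri : 1 + τ ≤ ‖(τ : ℂ) - z‖ + ‖1 + z‖ := by
    have hadd : (τ : ℂ) - z + (1 + z) = ((1 + τ : ℝ) : ℂ) := by push_cast; ring
    have := norm_add_le ((τ : ℂ) - z) (1 + z)
    rwa [hadd, Complex.norm_real, Real.norm_of_nonneg (by linarith)] at this
  have hscale : ‖1 + z‖ ≤ ‖1 + z‖ / |z.im| * ‖(τ : ℂ) - z‖ := by
    rw [div_mul_eq_mul_div, le_div_iff₀ (abs_pos.2 hz)]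
    gcongr
  rw [norm_div, norm_one, mul_one_div, div_le_div_iff₀ hpos (by linarith)]
  linarith

theorem IsStieltjes.kernelNonneg [FiniteDimensional ℂ E] {V : ℂ → E →L[ℂ] E}
    (hV : IsStieltjes V) : KernelNonneg V := by
  obtain ⟨-, γ, G, hG, hγ, hint, hrep⟩ := hV
  have hcell : ∀ n j : ℕ, ((j : ℝ) - 1) / ((n : ℝ) + 1) ≤ (j : ℝ) / ((n : ℝ) + 1) := fun n j => by
    gcongr
    linarith
  choose D hDpos hD using fun n j => hG.exists_isPositive_inner_eq_measureReal_Ioc (hcell n j)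
  refine KernelNonneg.of_tendsto (l := atTop) (V := fun (n : ℕ) z => γ +
    ∑ j ∈ Finset.range ((n + 1) * (n + 1)), (1 / (((j : ℝ) / ((n : ℝ) + 1) : ℝ) - z)) • D n j)
    (fun n => (KernelNonneg.const hγ).add (KernelNonneg.sum _ fun j _ =>
      KernelNonneg.inv_sub_smul (hDpos n j) (by positivity))) fun z hz e => ?_
  have hμ : ∀ᵐ t ∂(hG.measure e), t ∈ Ici (0 : ℝ) := hG.ae_measure_nonneg e
  have hint := hint e
  have : IsLocallyFiniteMeasure (hG.measure e) :=
    inferInstanceAs (IsLocallyFiniteMeasure (hG.monotone e).stieltjesFunction.measure)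
  rw [IntegrableOn, Measure.restrict_eq_self_of_ae_mem hμ] at hint
  rw [hrep z hz e, Measure.restrict_eq_self_of_ae_mem hμ]
  have hcont : Continuous fun t : ℝ => 1 / ((t : ℂ) - z) :=
    continuous_const.div (by fun_prop) (ofReal_sub_ne_zero hz)
  have hsum := tendsto_sum_measureReal_gridCell_smul hμ (hint.const_mul _) hcont
    fun t ht τ => norm_one_div_ofReal_sub_le hz ht
  refine (hsum.const_add ⟪e, γ e⟫_ℂ).congr fun n => ?_
  simp only [add_apply, inner_add_right, sum_apply, inner_sum, smul_apply, inner_smul_right, hD,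
    Complex.real_smul, gridCell, mul_comm]

end StieltjesKernel

namespace RiggedSystem

section HPlus

variable {H : Type*} [NormedAddCommGroup H] [InnerProductSpace ℂ H] [CompleteSpace H]
variable {A S S' : H →ₗ.[ℂ] H}

theorem HPlus.norm_sq (f : HPlus A) :
    ‖f‖ ^ 2 = ‖HPlus.incl A f‖ ^ 2 + ‖HPlus.star A f‖ ^ 2 := by
  rw [← inner_self_eq_norm_sq (𝕜 := ℂ) f, HPlus.inner_def, map_add, inner_self_eq_norm_sq,
    inner_self_eq_norm_sq]

theorem HPlus.norm_star_le (f : HPlus A) : ‖HPlus.star A f‖ ≤ 1 * ‖f‖ := by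
  rw [one_mul]
  exact le_of_sq_le_sq (by linarith [HPlus.norm_sq f, sq_nonneg ‖HPlus.incl A f‖])
    (norm_nonneg _)

theorem HPlus.norm_le (f : HPlus A) : ‖f‖ ≤ ‖HPlus.incl A f‖ + ‖HPlus.star A f‖ :=
  le_of_sq_le_sq (by
    nlinarith [HPlus.norm_sq f, mul_nonneg (norm_nonneg (HPlus.incl A f))
      (norm_nonneg (HPlus.star A f))]) (by positivity)

variable (A) in
/-- The operator `A*` as a bounded operator from `H₊` to `H`. -/
noncomputable def HPlus.starL : HPlus A →L[ℂ] H :=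
  (HPlus.star A).mkContinuous 1 HPlus.norm_star_le

variable (A) in
/-- The defect subspace `ker (A* - z I)`, as a subspace of `H₊`. -/
noncomputable def HPlus.defect (z : ℂ) : Submodule ℂ (HPlus A) :=
  LinearMap.ker (HPlus.star A - z • HPlus.incl A)

theorem HPlus.mem_defect {z : ℂ} {f : HPlus A} :
    f ∈ HPlus.defect A z ↔ HPlus.star A f = z • HPlus.incl A f := by
  rw [HPlus.defect, LinearMap.mem_ker]
  exact sub_eq_zero

theorem HPlus.incl_injective : Function.Injective (HPlus.incl A) := fun _ _ h => Subtype.ext h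

theorem HPlus.inner_star (hA : Dense (A.domain : Set H)) (f : HPlus A) (a : A.domain) :
    ⟪HPlus.star A f, (a : H)⟫_ℂ = ⟪HPlus.incl A f, A a⟫_ℂ :=
  LinearPMap.adjoint_isFormalAdjoint hA (show A†.domain from f) a

theorem HPlus.exists_of_inner (hA : Dense (A.domain : Set H)) {x y : H}
    (h : ∀ a : A.domain, ⟪y, (a : H)⟫_ℂ = ⟪x, A a⟫_ℂ) :
    ∃ f : HPlus A, HPlus.incl A f = x ∧ HPlus.star A f = y := by
  have hx : x ∈ A†.domain := LinearPMap.mem_adjoint_domain_of_exists x ⟨y, h⟩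
  exact ⟨(⟨x, hx⟩ : A†.domain), rfl, LinearPMap.adjoint_apply_eq hA ⟨x, hx⟩ h⟩

theorem HPlus.exists_of_isFormalAdjoint (hA : Dense (A.domain : Set H))
    (hSS' : S.IsFormalAdjoint S') (hAS' : A ≤ S') (s : S.domain) :
    ∃ f : HPlus A, HPlus.incl A f = s ∧ HPlus.star A f = S s :=
  HPlus.exists_of_inner hA fun a => by
    rw [hSS' s ⟨a, hAS'.1 a.2⟩, ← hAS'.2 (x := a) rfl]

theorem HPlus.completeSpace (hA : Dense (A.domain : Set H)) : CompleteSpace (HPlus A) := by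
  refine Metric.complete_of_cauchySeq_tendsto fun u hu => ?_
  obtain ⟨x, hx⟩ := cauchySeq_tendsto_of_complete
    ((HPlus.inclL A).uniformContinuous.comp_cauchySeq hu)
  obtain ⟨y, hy⟩ := cauchySeq_tendsto_of_complete
    ((HPlus.starL A).uniformContinuous.comp_cauchySeq hu)
  obtain ⟨f, rfl, rfl⟩ : ∃ f : HPlus A, HPlus.incl A f = x ∧ HPlus.star A f = y :=
    HPlus.exists_of_inner hA fun a => by
      refine tendsto_nhds_unique (hy.inner tendsto_const_nhds) ?_
      refine (hx.inner (tendsto_const_nhds (x := A a))).congr fun n => ?_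
      exact (HPlus.inner_star hA (u n) a).symm
  refine ⟨f, tendsto_iff_norm_sub_tendsto_zero.2 ?_⟩
  have hgraph := (tendsto_iff_norm_sub_tendsto_zero.1 hx).add
    (tendsto_iff_norm_sub_tendsto_zero.1 hy)
  rw [add_zero] at hgraph
  refine squeeze_zero (fun n => norm_nonneg _) (fun n => ?_) hgraph
  have hle := HPlus.norm_le (u n - f)
  rw [map_sub, map_sub] at hle
  exact hle

end HPlus

section Boundary

variable {H : Type*} [NormedAddCommGroup H] [InnerProductSpace ℂ H] [CompleteSpace H]
variable {A S S' : H →ₗ.[ℂ] H} {B : HPlus A →L[ℂ] HMinus A}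

/-- The operator `B - A*` from `H₊` to `H₋`. It annihilates exactly the `f ∈ H₊` with
`B f = A* f`; for a self-adjoint bi-extension `B` these form the domain of the quasi-kernel. -/
noncomputable def boundaryPart (B : HPlus A →L[ℂ] HMinus A) : HPlus A →L[ℂ] HMinus A :=
  B - (HMinus.ofH A).comp (HPlus.starL A)

theorem boundaryPart_apply (B : HPlus A →L[ℂ] HMinus A) (f : HPlus A) :
    boundaryPart B f = B f - HMinus.ofH A (HPlus.star A f) := rfl

theorem boundaryPart_apply_eq_zero {f : HPlus A} :
    boundaryPart B f = 0 ↔ B f = HMinus.ofH A (HPlus.star A f) := sub_eq_zero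

/-- The operator `B - z I` from `H₊` to `H₋`. -/
noncomputable def shift (B : HPlus A →L[ℂ] HMinus A) (z : ℂ) : HPlus A →L[ℂ] HMinus A :=
  B - z • (HMinus.ofH A).comp (HPlus.inclL A)

theorem shift_apply (B : HPlus A →L[ℂ] HMinus A) (z : ℂ) (f : HPlus A) :
    shift B z f = B f - z • HMinus.ofH A (HPlus.incl A f) := rfl

theorem shift_eq_boundaryPart_add (B : HPlus A →L[ℂ] HMinus A) (z : ℂ) (f : HPlus A) :
    shift B z f = boundaryPart B f + HMinus.ofH A (HPlus.star A f - z • HPlus.incl A f) := by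
  rw [shift_apply, boundaryPart_apply, map_sub, map_smul]
  abel

theorem Extends.boundaryPart_apply_eq_zero (hA : Dense (A.domain : Set H)) (hB : Extends B S)
    (hSS' : S.IsFormalAdjoint S') (hAS' : A ≤ S') {g : HPlus A} (hg : HPlus.incl A g ∈ S.domain) :
    boundaryPart B g = 0 := by
  obtain ⟨f, hf, hBf⟩ := hB ⟨_, hg⟩
  obtain ⟨k, hk, hkS⟩ := HPlus.exists_of_isFormalAdjoint hA hSS' hAS' ⟨_, hg⟩
  obtain rfl : f = g := HPlus.incl_injective hf
  obtain rfl : k = f := HPlus.incl_injective hk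
  rw [boundaryPart_apply, hBf, hkS, sub_self]

theorem Extends.ofH_injective (hA : Dense (A.domain : Set H)) (hB : Extends B A) :
    Function.Injective (HMinus.ofH A) := by
  intro h k hhk
  refine hA.eq_of_inner_right ℂ fun a ha => ?_
  obtain ⟨f, hf, -⟩ := hB ⟨a, ha⟩
  have hfhk := congrArg (fun φ : HMinus A => φ f) hhk
  simpa only [HMinus.ofH_apply, hf] using hfhk

theorem Extends.mem_graph_quasiKernel_iff (hA : Dense (A.domain : Set H)) (hB : Extends B A)
    {x y : H} :
    (x, y) ∈ (quasiKernel B).graph ↔ ∃ f, HPlus.incl A f = x ∧ B f = HMinus.ofH A y := by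
  rw [quasiKernel, Submodule.toLinearPMap_graph_eq]
  · rfl
  · rintro ⟨p, q⟩ ⟨f, hf, hBf⟩ (rfl : p = 0)
    obtain rfl : f = 0 := HPlus.incl_injective (hf.trans (map_zero _).symm)
    exact hB.ofH_injective hA (by rw [← hBf, map_zero, map_zero])

end Boundary

section BiExtension

variable {H : Type*} [NormedAddCommGroup H] [InnerProductSpace ℂ H] [CompleteSpace H]
variable {A : H →ₗ.[ℂ] H} {B : HPlus A →L[ℂ] HMinus A}

theorem IsSelfAdjointBiExtension.conj_apply (hB : IsSelfAdjointBiExtension B) (f g : HPlus A) :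
    conj (B g f) = B f g := by
  conv_rhs => rw [← hB.adj_eq]
  rfl

theorem IsSelfAdjointBiExtension.apply_self_im (hB : IsSelfAdjointBiExtension B) (f : HPlus A) :
    (B f f).im = 0 := Complex.conj_eq_iff_im.1 (hB.conj_apply f f)

theorem IsSelfAdjointBiExtension.star_eq (hB : IsSelfAdjointBiExtension B)
    (hA : Dense (A.domain : Set H)) {f : HPlus A} {h : H} (hf : B f = HMinus.ofH A h) :
    HPlus.star A f = h := by
  refine hA.eq_of_inner_left ℂ fun a ha => ?_
  obtain ⟨g, hg, hBg⟩ := hB.extends_base ⟨a, ha⟩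
  have hsymm := hB.conj_apply f g
  rw [hf, hBg, HMinus.ofH_apply, HMinus.ofH_apply, hg, inner_conj_symm] at hsymm
  rw [HPlus.inner_star hA f ⟨a, ha⟩, ← inner_conj_symm, hsymm, inner_conj_symm]

theorem IsSelfAdjointBiExtension.exists_of_inner (hB : IsSelfAdjointBiExtension B)
    (hA : Dense (A.domain : Set H)) {x y : H}
    (h : ∀ g, boundaryPart B g = 0 → ⟪HPlus.star A g, x⟫_ℂ = ⟪HPlus.incl A g, y⟫_ℂ) :
    ∃ f, HPlus.incl A f = x ∧ HPlus.star A f = y ∧ boundaryPart B f = 0 := by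
  have hmem : (x, y) ∈ (quasiKernel B)†.graph := by
    rw [LinearPMap.adjoint_graph_eq_graph_adjoint hB.isSelfAdjoint_quasiKernel.dense_domain,
      Submodule.mem_adjoint_iff]
    intro a b hab
    obtain ⟨g, rfl, hBg⟩ := (hB.extends_base.mem_graph_quasiKernel_iff hA).1 hab
    obtain rfl := hB.star_eq hA hBg
    rw [h g (boundaryPart_apply_eq_zero.2 hBg), sub_self]
  rw [LinearPMap.isSelfAdjoint_def.1 hB.isSelfAdjoint_quasiKernel,
    hB.extends_base.mem_graph_quasiKernel_iff hA] at hmem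
  obtain ⟨f, hf, hBf⟩ := hmem
  obtain rfl := hB.star_eq hA hBf
  exact ⟨f, hf, rfl, boundaryPart_apply_eq_zero.2 hBf⟩

end BiExtension

section Resolvent

variable {H : Type*} [NormedAddCommGroup H] [InnerProductSpace ℂ H] [CompleteSpace H]
variable {A : H →ₗ.[ℂ] H} {B : HPlus A →L[ℂ] HMinus A} {z : ℂ} {c : ℝ} {r : H →L[ℂ] HPlus A}

/-- The operator `A* - z I` is bounded from below by `c` on the kernel of `B - A*`, that is, for a
self-adjoint bi-extension `B`, on the domain of its quasi-kernel. -/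
def IsBoundedBelowAt (B : HPlus A →L[ℂ] HMinus A) (z : ℂ) (c : ℝ) : Prop :=
  ∀ f, boundaryPart B f = 0 → c * ‖HPlus.incl A f‖ ≤ ‖HPlus.star A f - z • HPlus.incl A f‖

/-- `r` is the resolvent at `z` of the quasi-kernel of `B`, regarded as an operator from `H` to
`H₊`. -/
def IsResolvent (B : HPlus A →L[ℂ] HMinus A) (z : ℂ) (r : H →L[ℂ] HPlus A) : Prop :=
  ∀ h, boundaryPart B (r h) = 0 ∧ HPlus.star A (r h) - z • HPlus.incl A (r h) = h

theorem IsBoundedBelowAt.norm_le (hb : IsBoundedBelowAt B z c) (hc : 0 < c) {f : HPlus A}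
    (hf : boundaryPart B f = 0) :
    ‖f‖ ≤ (1 + (1 + ‖z‖) / c) * ‖HPlus.star A f - z • HPlus.incl A f‖ := by
  set y := HPlus.star A f - z • HPlus.incl A f
  have hincl : ‖HPlus.incl A f‖ ≤ ‖y‖ / c := by
    rw [le_div_iff₀ hc, mul_comm]
    exact hb f hf
  have hstar : ‖HPlus.star A f‖ ≤ ‖y‖ + ‖z‖ * ‖HPlus.incl A f‖ := by
    rw [← norm_smul]
    exact norm_le_norm_sub_add _ _
  calc ‖f‖ ≤ ‖HPlus.incl A f‖ + ‖HPlus.star A f‖ := HPlus.norm_le f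
    _ ≤ ‖y‖ + (1 + ‖z‖) * ‖HPlus.incl A f‖ := by linarith
    _ ≤ ‖y‖ + (1 + ‖z‖) * (‖y‖ / c) := by gcongr
    _ = (1 + (1 + ‖z‖) / c) * ‖y‖ := by ring

theorem IsBoundedBelowAt.eq_zero (hb : IsBoundedBelowAt B z c) (hc : 0 < c) {f : HPlus A}
    (hf : boundaryPart B f = 0) (hz : HPlus.star A f = z • HPlus.incl A f) : f = 0 := by
  have hle := hb.norm_le hc hf
  rwa [hz, sub_self, norm_zero, mul_zero, norm_le_zero_iff] at hle

theorem IsBoundedBelowAt.shift_injective (hb : IsBoundedBelowAt B z c) (hc : 0 < c)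
    (hB : IsSelfAdjointBiExtension B) (hA : Dense (A.domain : Set H)) :
    Function.Injective (shift B z) := by
  refine (injective_iff_map_eq_zero _).2 fun f hf => ?_
  rw [shift_apply, sub_eq_zero, ← map_smul] at hf
  have hstar := hB.star_eq hA hf
  exact hb.eq_zero hc (boundaryPart_apply_eq_zero.2 (by rw [hf, hstar])) hstar

/-- The operator `A* - z I` on the kernel of `B - A*`. -/
noncomputable def kernelShift (B : HPlus A →L[ℂ] HMinus A) (z : ℂ) :
    (boundaryPart B).ker →L[ℂ] H :=
  (HPlus.starL A - z • HPlus.inclL A).comp (boundaryPart B).ker.subtypeL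

theorem kernelShift_apply (f : (boundaryPart B).ker) :
    kernelShift B z f = HPlus.star A f - z • HPlus.incl A (f : HPlus A) := rfl

theorem IsBoundedBelowAt.exists_antilipschitzWith (hb : IsBoundedBelowAt B z c) (hc : 0 < c) :
    ∃ K, AntilipschitzWith K (kernelShift B z) :=
  ⟨_, AddMonoidHomClass.antilipschitz_of_bound (K := Real.toNNReal (1 + (1 + ‖z‖) / c))
    (kernelShift B z) fun f => by
      rw [Real.coe_toNNReal _ (by positivity)]
      exact hb.norm_le hc (LinearMap.mem_ker.1 f.2)⟩

theorem IsSelfAdjointBiExtension.topologicalClosure_range_kernelShift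
    (hB : IsSelfAdjointBiExtension B) (hA : Dense (A.domain : Set H)) (hc : 0 < c)
    (hb : IsBoundedBelowAt B (conj z) c) :
    (kernelShift B z).range.topologicalClosure = ⊤ := by
  rw [Submodule.topologicalClosure_eq_top_iff, Submodule.eq_bot_iff]
  intro x hx
  obtain ⟨f, rfl, hstar, hf⟩ := hB.exists_of_inner hA (x := x) (y := conj z • x) fun g hg => by
    have hgx := hx (kernelShift B z ⟨g, LinearMap.mem_ker.2 hg⟩) ⟨_, rfl⟩
    rwa [kernelShift_apply, inner_sub_left, inner_smul_left, sub_eq_zero,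
      ← inner_smul_right] at hgx
  rw [hb.eq_zero hc hf hstar, map_zero]

theorem IsSelfAdjointBiExtension.exists_isResolvent (hB : IsSelfAdjointBiExtension B)
    (hA : Dense (A.domain : Set H)) (hc : 0 < c) (hb : IsBoundedBelowAt B z c)
    (hb' : IsBoundedBelowAt B (conj z) c) : ∃ r, IsResolvent B z r := by
  have := HPlus.completeSpace hA
  have : CompleteSpace (boundaryPart B).ker := (boundaryPart B).isClosed_ker.completeSpace_coe
  have hbij : Function.Bijective (kernelShift B z) :=
    (ContinuousLinearMap.bijective_iff_dense_range_and_antilipschitz _).2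
      ⟨hB.topologicalClosure_range_kernelShift hA hc hb', hb.exists_antilipschitzWith hc⟩
  let e := ContinuousLinearEquiv.ofBijective (kernelShift B z) (LinearMap.ker_eq_bot.2 hbij.1)
    (LinearMap.range_eq_top.2 hbij.2)
  exact ⟨(boundaryPart B).ker.subtypeL.comp (e.symm : H →L[ℂ] (boundaryPart B).ker), fun h =>
    ⟨LinearMap.mem_ker.1 (e.symm h).2, e.apply_symm_apply h⟩⟩

theorem IsResolvent.star_apply (hr : IsResolvent B z r) (h : H) :
    HPlus.star A (r h) = h + z • HPlus.incl A (r h) := sub_eq_iff_eq_add.1 (hr h).2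

theorem IsResolvent.shift_eq_ofH (hr : IsResolvent B z r) (h : H) :
    shift B z (r h) = HMinus.ofH A h := by
  rw [shift_eq_boundaryPart_add, (hr h).1, (hr h).2, zero_add]

theorem IsResolvent.exists_shift_eq (hr : IsResolvent B z r) (f : HPlus A) (h : H) :
    ∃ g, shift B z g = boundaryPart B f + HMinus.ofH A h :=
  ⟨f + r (h - (HPlus.star A f - z • HPlus.incl A f)), by
    rw [map_add, hr.shift_eq_ofH, shift_eq_boundaryPart_add, add_assoc, ← map_add, add_sub_cancel]⟩

theorem IsResolvent.sub_mem_defect (hr : IsResolvent B z r) (f : HPlus A) :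
    f - r (HPlus.star A f - z • HPlus.incl A f) ∈ HPlus.defect A z := by
  rw [HPlus.mem_defect, map_sub (HPlus.star A), map_sub (HPlus.incl A), hr.star_apply]
  module

end Resolvent

theorem mul_norm_le_norm_of_le_norm_inner {H : Type*} [NormedAddCommGroup H]
    [InnerProductSpace ℂ H] {x y : H} {c : ℝ} (h : c * ‖x‖ ^ 2 ≤ ‖⟪x, y⟫_ℂ‖) :
    c * ‖x‖ ≤ ‖y‖ := by
  rcases eq_or_ne x 0 with rfl | hx
  · simp
  · refine le_of_mul_le_mul_left ?_ (norm_pos_iff.2 hx)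
    calc ‖x‖ * (c * ‖x‖) = c * ‖x‖ ^ 2 := by ring
      _ ≤ ‖x‖ * ‖y‖ := h.trans (norm_inner_le_norm x y)

theorem inner_self_eq_ofReal_norm_sq {H : Type*} [NormedAddCommGroup H] [InnerProductSpace ℂ H]
    (x : H) : ⟪x, x⟫_ℂ = ((‖x‖ ^ 2 : ℝ) : ℂ) := by
  rw [inner_self_eq_norm_sq_to_K]
  norm_cast

section LowerBounds

variable {H : Type*} [NormedAddCommGroup H] [InnerProductSpace ℂ H] [CompleteSpace H]
variable {A : H →ₗ.[ℂ] H} {B : HPlus A →L[ℂ] HMinus A} {z : ℂ}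

theorem IsSelfAdjointBiExtension.isBoundedBelowAt (hB : IsSelfAdjointBiExtension B) (z : ℂ) :
    IsBoundedBelowAt B z |z.im| := by
  intro f hf
  refine mul_norm_le_norm_of_le_norm_inner (le_trans (le_of_eq ?_) (Complex.abs_im_le_norm _))
  have him := hB.apply_self_im f
  rw [boundaryPart_apply_eq_zero.1 hf, HMinus.ofH_apply] at him
  rw [inner_sub_right, inner_smul_right, Complex.sub_im, him, inner_self_eq_ofReal_norm_sq,
    Complex.im_mul_ofReal, zero_sub, abs_neg, abs_mul, abs_of_nonneg (sq_nonneg ‖_‖)]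

theorem IsSelfAdjointBiExtension.exists_isResolvent_of_im_ne_zero
    (hB : IsSelfAdjointBiExtension B) (hA : Dense (A.domain : Set H)) (hz : z.im ≠ 0) :
    ∃ r, IsResolvent B z r :=
  hB.exists_isResolvent hA (abs_pos.2 hz) (hB.isBoundedBelowAt z) (by
    simpa using hB.isBoundedBelowAt (conj z))

theorem IsAccretive.isBoundedBelowAt_neg_one (hacc : IsAccretive B) :
    IsBoundedBelowAt B (-1) 1 := by
  intro f hf
  refine mul_norm_le_norm_of_le_norm_inner
    (le_trans ?_ ((le_abs_self _).trans (Complex.abs_re_le_norm _)))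
  have hre := hacc f
  rw [boundaryPart_apply_eq_zero.1 hf, HMinus.ofH_apply] at hre
  rw [neg_one_smul, sub_neg_eq_add, inner_add_right, Complex.add_re,
    inner_self_eq_ofReal_norm_sq, Complex.ofReal_re]
  linarith

theorem IsAccretive.exists_isResolvent_neg_one (hacc : IsAccretive B)
    (hB : IsSelfAdjointBiExtension B) (hA : Dense (A.domain : Set H)) :
    ∃ r, IsResolvent B (-1) r :=
  hB.exists_isResolvent hA one_pos hacc.isBoundedBelowAt_neg_one (by
    simpa using hacc.isBoundedBelowAt_neg_one)

end LowerBounds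

section AccretiveBiExtension

variable {H : Type*} [NormedAddCommGroup H] [InnerProductSpace ℂ H] [CompleteSpace H]
variable {A : H →ₗ.[ℂ] H} {B : HPlus A →L[ℂ] HMinus A} {r : H →L[ℂ] HPlus A}

theorem shift_neg_one_apply (B : HPlus A →L[ℂ] HMinus A) (f g : HPlus A) :
    shift B (-1) f g = B f g + ⟪HPlus.incl A g, HPlus.incl A f⟫_ℂ := by
  rw [shift_apply, sub_apply, smul_apply, HMinus.ofH_apply, neg_one_smul, sub_neg_eq_add]

theorem re_shift_neg_one_apply_self (B : HPlus A →L[ℂ] HMinus A) (f : HPlus A) :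
    (shift B (-1) f f).re = (B f f).re + ‖HPlus.incl A f‖ ^ 2 := by
  rw [shift_neg_one_apply, Complex.add_re, inner_self_eq_ofReal_norm_sq, Complex.ofReal_re]

theorem IsAccretive.re_shift_neg_one_nonneg (hacc : IsAccretive B) (f : HPlus A) :
    0 ≤ (shift B (-1) f f).re := by
  rw [re_shift_neg_one_apply_self]
  exact add_nonneg (hacc f) (sq_nonneg _)

theorem IsSelfAdjointBiExtension.conj_shift_neg_one_apply (hB : IsSelfAdjointBiExtension B)
    (f g : HPlus A) : conj (shift B (-1) g f) = shift B (-1) f g := by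
  rw [shift_neg_one_apply, shift_neg_one_apply, map_add, hB.conj_apply, inner_conj_symm]

theorem IsAccretive.norm_shift_neg_one_sq_le (hacc : IsAccretive B)
    (hB : IsSelfAdjointBiExtension B) (f g : HPlus A) :
    ‖shift B (-1) f g‖ ^ 2 ≤ (shift B (-1) f f).re * (shift B (-1) g g).re := by
  let form : PreInnerProductSpace.Core ℂ (HPlus A) :=
    { inner := fun f g => shift B (-1) g f
      conj_inner_symm := fun f g => hB.conj_shift_neg_one_apply g f
      re_inner_nonneg := hacc.re_shift_neg_one_nonneg
      add_left := fun f g h => by simp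
      smul_left := fun f g c => by simp }
  have hCS : ‖shift B (-1) g f‖ * ‖shift B (-1) f g‖ ≤
      (shift B (-1) f f).re * (shift B (-1) g g).re :=
    @InnerProductSpace.Core.inner_mul_inner_self_le ℂ (HPlus A) _ _ _ form f g
  rwa [← hB.conj_shift_neg_one_apply g f, RCLike.norm_conj, ← sq] at hCS

theorem IsResolvent.inner_incl {z : ℂ} (hr : IsResolvent B z r) (h : H) (f : HPlus A) :
    ⟪HPlus.incl A f, h⟫_ℂ = shift B z (r h) f := by
  rw [hr.shift_eq_ofH, HMinus.ofH_apply]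

theorem IsResolvent.eq_add_smul {w z : ℂ} (hr : IsResolvent B w r)
    (hinj : Function.Injective (shift B w)) {u v : HPlus A} (huv : shift B w u = shift B z v) :
    v = u + (z - w) • r (HPlus.incl A v) := by
  refine hinj ?_
  rw [map_add, map_smul, hr.shift_eq_ofH, huv, shift_apply, shift_apply]
  module

theorem IsResolvent.isSelfAdjoint_neg_one (hr : IsResolvent B (-1) r)
    (hB : IsSelfAdjointBiExtension B) : IsSelfAdjoint ((HPlus.inclL A).comp r) := by
  rw [ContinuousLinearMap.isSelfAdjoint_iff_isSymmetric]
  intro h k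
  change ⟪HPlus.incl A (r h), k⟫_ℂ = ⟪h, HPlus.incl A (r k)⟫_ℂ
  rw [← inner_conj_symm h, hr.inner_incl, hr.inner_incl, hB.conj_shift_neg_one_apply]

theorem IsResolvent.norm_sq_le_re_inner (hr : IsResolvent B (-1) r) (hacc : IsAccretive B)
    (h : H) : ‖HPlus.incl A (r h)‖ ^ 2 ≤ (⟪HPlus.incl A (r h), h⟫_ℂ).re := by
  rw [hr.inner_incl, re_shift_neg_one_apply_self]
  linarith [hacc (r h)]

theorem IsResolvent.norm_inclL_comp_le_one (hr : IsResolvent B (-1) r) (hacc : IsAccretive B) :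
    ‖(HPlus.inclL A).comp r‖ ≤ 1 := by
  refine ContinuousLinearMap.opNorm_le_bound _ zero_le_one fun h => ?_
  have hle : 1 * ‖HPlus.incl A (r h)‖ ≤ ‖h‖ := mul_norm_le_norm_of_le_norm_inner (by
    rw [one_mul]
    exact (hr.norm_sq_le_re_inner hacc h).trans (Complex.re_le_norm _))
  rwa [one_mul] at hle ⊢

theorem IsResolvent.spectrum_subset_Icc (hr : IsResolvent B (-1) r)
    (hB : IsSelfAdjointBiExtension B) (hacc : IsAccretive B) :
    spectrum ℝ ((HPlus.inclL A).comp r) ⊆ Icc 0 1 := by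
  intro s hs
  constructor
  · refine spectrum_nonneg_of_nonneg ?_ hs
    rw [ContinuousLinearMap.nonneg_iff_isPositive, ContinuousLinearMap.isPositive_def]
    exact ⟨(hr.isSelfAdjoint_neg_one hB).isSymmetric, fun h =>
      (sq_nonneg _).trans (hr.norm_sq_le_re_inner hacc h)⟩
  · calc s ≤ ‖s‖ := le_abs_self s
      _ ≤ _ := spectrum.norm_le_norm_mul_of_mem hs
      _ ≤ 1 * 1 := by
        gcongr
        exacts [hr.norm_inclL_comp_le_one hacc, ContinuousLinearMap.norm_id_le]
      _ = 1 := one_mul 1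

end AccretiveBiExtension

section DefectSpan

variable {H : Type*} [NormedAddCommGroup H] [InnerProductSpace ℂ H] [CompleteSpace H]
variable {A : H →ₗ.[ℂ] H} {B : HPlus A →L[ℂ] HMinus A} {Z : Set ℂ} {w : ℂ}

variable (A) in
/-- The span in `H₊` of the defect subspaces with index in `Z`. -/
noncomputable def defectSpan (Z : Set ℂ) : Submodule ℂ (HPlus A) :=
  Submodule.span ℂ {f | ∃ z ∈ Z, f ∈ HPlus.defect A z}

theorem IsSelfAdjointBiExtension.mem_closure_defectSpan (hB : IsSelfAdjointBiExtension B)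
    (hA : Dense (A.domain : Set H)) (hZ : ∀ z ∈ Z, z.im ≠ 0) (hwZ : w ∈ closure Z)
    (hw : w.im ≠ 0) {f : HPlus A} (hf : f ∈ HPlus.defect A w) :
    f ∈ (defectSpan A Z).topologicalClosure := by
  obtain ⟨z, hzZ, hz⟩ := mem_closure_iff_seq_limit.1 hwZ
  have hzim := fun n => hZ (z n) (hzZ n)
  choose r hr using fun n => hB.exists_isResolvent_of_im_ne_zero hA (hzim n)
  set x := HPlus.incl A f
  have hdefect : ∀ n, f - (w - z n) • r n x ∈ HPlus.defect A (z n) := fun n => by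
    rw [← map_smul, sub_smul, ← HPlus.mem_defect.1 hf]
    exact (hr n).sub_mem_defect f
  have hbound : ∀ n, ‖(w - z n) • r n x‖ ≤
      ‖w - z n‖ * ((1 + (1 + ‖z n‖) / |(z n).im|) * ‖x‖) := fun n => by
    have hle := (hB.isBoundedBelowAt (z n)).norm_le (abs_pos.2 (hzim n)) (hr n x).1
    rw [(hr n x).2] at hle
    rw [norm_smul]
    gcongr
  have hlim : Tendsto (fun n => ‖w - z n‖ * ((1 + (1 + ‖z n‖) / |(z n).im|) * ‖x‖)) atTop
      (𝓝 0) := by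
    have him : Tendsto (fun n => |(z n).im|) atTop (𝓝 |w.im|) :=
      ((Complex.continuous_im.tendsto w).comp hz).abs
    have hmul := (hz.const_sub w).norm.mul
      ((((hz.norm.const_add 1).div him (abs_ne_zero.2 hw)).const_add 1).mul_const ‖x‖)
    rwa [sub_self, norm_zero, zero_mul] at hmul
  have htends : Tendsto (fun n => f - (w - z n) • r n x) atTop (𝓝 f) := by
    simpa using (squeeze_zero_norm hbound hlim).const_sub f
  exact mem_closure_of_tendsto htends (Eventually.of_forall fun n =>
    Submodule.subset_span ⟨z n, hzZ n, hdefect n⟩)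

theorem IsSelfAdjointBiExtension.resolvent_mem_closure_defectSpan
    (hB : IsSelfAdjointBiExtension B) (hA : Dense (A.domain : Set H)) {ζ : ℂ} (hζ : ζ.im ≠ 0)
    (hζZ : ζ ∉ Z) (hζcl : ζ ∈ closure Z) (hZ : ∀ z ∈ Z, z.im ≠ 0) {r : H →L[ℂ] HPlus A}
    (hr : IsResolvent B ζ r) {f : HPlus A} (hf : f ∈ (defectSpan A Z).topologicalClosure) :
    r (HPlus.incl A f) ∈ (defectSpan A Z).topologicalClosure := by
  have hle : (defectSpan A Z).topologicalClosure ≤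
      (defectSpan A Z).topologicalClosure.comap (r.comp (HPlus.inclL A)).toLinearMap := by
    refine Submodule.topologicalClosure_minimal _ (Submodule.span_le.2 ?_)
      ((Submodule.isClosed_topologicalClosure _).preimage (r.comp (HPlus.inclL A)).continuous)
    rintro g ⟨w, hwZ, hg⟩
    have hsub := hr.sub_mem_defect g
    rw [HPlus.mem_defect.1 hg, ← sub_smul, map_smul] at hsub
    have hgZ : g ∈ defectSpan A Z := Submodule.subset_span ⟨w, hwZ, hg⟩
    have hmem := Submodule.sub_mem _ (Submodule.le_topologicalClosure _ hgZ)
      (hB.mem_closure_defectSpan hA hZ hζcl hζ hsub)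
    rw [sub_sub_cancel] at hmem
    have hwζ : w - ζ ≠ 0 := sub_ne_zero.2 fun h => hζZ (h ▸ hwZ)
    rwa [Submodule.smul_mem_iff _ hwζ] at hmem
  exact hle hf

theorem IsSelfAdjointBiExtension.topologicalClosure_defectSpan_eq_top
    (hB : IsSelfAdjointBiExtension B) (hA : Dense (A.domain : Set H)) {ζ : ℂ} (hζ : ζ.im ≠ 0)
    (hζZ : ζ ∉ Z) (hZ : ∀ z ∈ Z, z.im ≠ 0) (hcl : ∀ z : ℂ, z.im ≠ 0 → z ∈ closure Z)
    {P : Set ℂ} (hP : ∀ z ∈ P, z.im ≠ 0) (htop : (⨆ z ∈ P, defect A z).topologicalClosure = ⊤) :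
    (defectSpan A Z).topologicalClosure = ⊤ := by
  obtain ⟨r, hr⟩ := hB.exists_isResolvent_of_im_ne_zero hA hζ
  have hrange : ⊤ ≤ (defectSpan A Z).topologicalClosure.comap r.toLinearMap := by
    rw [← htop]
    refine Submodule.topologicalClosure_minimal _ (iSup₂_le fun z hz => ?_)
      ((Submodule.isClosed_topologicalClosure _).preimage r.continuous)
    rintro _ ⟨f, hf, rfl⟩
    exact hB.resolvent_mem_closure_defectSpan hA hζ hζZ (hcl ζ hζ) hZ hr
      (hB.mem_closure_defectSpan hA hZ (hcl z (hP z hz)) (hP z hz) hf)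
  have hr_mem : ∀ h, r h ∈ (defectSpan A Z).topologicalClosure := fun h => hrange Submodule.mem_top
  exact Submodule.eq_top_iff'.2 fun f => (Submodule.sub_mem_iff_left _ (hr_mem _)).1
    (hB.mem_closure_defectSpan hA hZ (hcl ζ hζ) hζ (hr.sub_mem_defect f))

end DefectSpan

section DomainDensity

variable {H : Type*} [NormedAddCommGroup H] [InnerProductSpace ℂ H] [CompleteSpace H]
variable {A S S' T : H →ₗ.[ℂ] H}

theorem IsRegularPoint.exists_adjoint_sub_smul_eq (hTd : Dense (T.domain : Set H)) {z : ℂ}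
    (hz : IsRegularPoint T z) (h : H) : ∃ t : T†.domain, T† t - conj z • (t : H) = h := by
  obtain ⟨R, -, hR⟩ := hz
  set x := ContinuousLinearMap.adjoint R h
  have hinner : ∀ t : T.domain, ⟪h + conj z • x, (t : H)⟫_ℂ = ⟪x, T t⟫_ℂ := fun t => by
    have hx : ⟪x, T t - z • (t : H)⟫_ℂ = ⟪h, (t : H)⟫_ℂ := by
      rw [ContinuousLinearMap.adjoint_inner_left, hR t]
    rw [inner_sub_right, inner_smul_right] at hx
    rw [inner_add_left, inner_smul_left, Complex.conj_conj, ← hx, sub_add_cancel]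
  have hx : x ∈ T†.domain := LinearPMap.mem_adjoint_domain_of_exists _ ⟨_, hinner⟩
  refine ⟨⟨x, hx⟩, ?_⟩
  rw [LinearPMap.adjoint_apply_eq hTd ⟨x, hx⟩ hinner, add_sub_cancel_right]

theorem IsRegularPoint.mem_domain_of_inner_adjoint (hTd : Dense (T.domain : Set H)) {z : ℂ}
    (hz : IsRegularPoint T z) {x y : H} (h : ∀ t : T†.domain, ⟪y, (t : H)⟫_ℂ = ⟪x, T† t⟫_ℂ) :
    x ∈ T.domain := by
  obtain ⟨R, hR, -⟩ := id hz
  obtain ⟨u, -, hu⟩ := hR (y - z • x)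
  have hux : (u : H) = x := by
    refine ext_inner_right ℂ fun k => ?_
    obtain ⟨t, rfl⟩ := hz.exists_adjoint_sub_smul_eq hTd k
    calc ⟪(u : H), T† t - conj z • (t : H)⟫_ℂ = ⟪T u - z • (u : H), (t : H)⟫_ℂ := by
          rw [inner_sub_right, inner_sub_left, inner_smul_right, inner_smul_left,
            (LinearPMap.adjoint_isFormalAdjoint hTd).symm u t]
      _ = ⟪x, T† t - conj z • (t : H)⟫_ℂ := by
          rw [hu, inner_sub_left, inner_sub_right, inner_smul_left, inner_smul_right, h t]
  exact hux ▸ u.2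

theorem HPlus.inner_neg_incl_of_orthogonal (hA : Dense (A.domain : Set H))
    (hSS' : S.IsFormalAdjoint S') (hAS' : A ≤ S') {f : HPlus A}
    (hf : ∀ g : HPlus A, HPlus.incl A g ∈ S.domain → ⟪f, g⟫_ℂ = 0) (s : S.domain) :
    ⟪-HPlus.incl A f, (s : H)⟫_ℂ = ⟪HPlus.star A f, S s⟫_ℂ := by
  obtain ⟨g, hg, hgS⟩ := HPlus.exists_of_isFormalAdjoint hA hSS' hAS' s
  have hfg := hf g (hg ▸ s.2)
  rw [HPlus.inner_def, hg, hgS] at hfg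
  rw [inner_neg_left, neg_eq_iff_add_eq_zero, hfg]

theorem HPlus.eq_zero_of_star_mem_domain (hA : Dense (A.domain : Set H)) {f : HPlus A}
    (hf : HPlus.star A f ∈ A.domain) (hAf : A ⟨HPlus.star A f, hf⟩ = -HPlus.incl A f) :
    f = 0 := by
  have hinner := HPlus.inner_star hA f ⟨_, hf⟩
  rw [hAf, inner_neg_right, inner_self_eq_ofReal_norm_sq, inner_self_eq_ofReal_norm_sq,
    ← Complex.ofReal_neg, Complex.ofReal_inj] at hinner
  have hnorm : ‖f‖ ^ 2 = 0 := by rw [HPlus.norm_sq, hinner, add_neg_cancel]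
  exact norm_eq_zero.1 (pow_eq_zero_iff two_ne_zero |>.1 hnorm)

theorem topologicalClosure_sup_comap_domain_eq_top (hA : Dense (A.domain : Set H)) (hT : A ≤ T)
    (hT' : A ≤ T†) (hdom : A.domain = T.domain ⊓ T†.domain) (hreg : ∃ z, IsRegularPoint T z) :
    (T.domain.comap (HPlus.incl A) ⊔ T†.domain.comap (HPlus.incl A)).topologicalClosure = ⊤ := by
  have := HPlus.completeSpace hA
  have hTd : Dense (T.domain : Set H) := hA.mono hT.1
  have hadj : T†.IsFormalAdjoint T := LinearPMap.adjoint_isFormalAdjoint hTd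
  rw [Submodule.topologicalClosure_eq_top_iff, Submodule.eq_bot_iff]
  intro f hf
  rw [Submodule.mem_orthogonal'] at hf
  have hfT := HPlus.inner_neg_incl_of_orthogonal hA hadj.symm hT' fun g hg =>
    hf g (Submodule.mem_sup_left hg)
  have hfT' := HPlus.inner_neg_incl_of_orthogonal hA hadj hT fun g hg =>
    hf g (Submodule.mem_sup_right hg)
  have hmem' : HPlus.star A f ∈ T†.domain :=
    LinearPMap.mem_adjoint_domain_of_exists _ ⟨_, hfT⟩
  have hmem : HPlus.star A f ∈ T.domain :=
    hreg.elim fun z hz => hz.mem_domain_of_inner_adjoint hTd hfT'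
  refine HPlus.eq_zero_of_star_mem_domain hA (hdom ▸ ⟨hmem, hmem'⟩) ?_
  rw [hT'.2 (y := ⟨_, hmem'⟩) rfl]
  exact LinearPMap.adjoint_apply_eq hTd ⟨_, hmem'⟩ hfT

end DomainDensity

theorem range_le_range_of_eqOn_smul {X Y : Type*} [NormedAddCommGroup X] [NormedSpace ℂ X]
    [NormedAddCommGroup Y] [NormedSpace ℂ Y] {L M : X →L[ℂ] Y} [FiniteDimensional ℂ L.range]
    {W W' : Submodule ℂ X} (hW : (W ⊔ W').topologicalClosure = ⊤) {a b : ℂ}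
    (ha : ∀ x ∈ W, M x = a • L x) (hb : ∀ x ∈ W', M x = b • L x) : M.range ≤ L.range := by
  have hcl : IsClosed ((L.range.comap M.toLinearMap : Submodule ℂ X) : Set X) :=
    L.range.closed_of_finiteDimensional.preimage M.continuous
  have hle : W ⊔ W' ≤ L.range.comap M.toLinearMap :=
    sup_le (fun x hx => ⟨a • x, by simpa using (ha x hx).symm⟩)
      fun x hx => ⟨b • x, by simpa using (hb x hx).symm⟩
  rintro _ ⟨x, rfl⟩
  exact (hW.ge.trans ((W ⊔ W').topologicalClosure_minimal hle hcl)) Submodule.mem_top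

section StarExtension

variable {H : Type*} [NormedAddCommGroup H] [InnerProductSpace ℂ H] [CompleteSpace H]
variable {A T : H →ₗ.[ℂ] H} {B : HPlus A →L[ℂ] HMinus A}

theorem boundaryPart_rePart_apply (B : HPlus A →L[ℂ] HMinus A) (f : HPlus A) :
    boundaryPart (rePart B) f =
      (1 / 2 : ℂ) • (boundaryPart B f + boundaryPart (adj B) f) := by
  simp only [boundaryPart_apply, rePart, smul_apply, add_apply]
  module

theorem imPart_apply_eq_boundaryPart_sub (B : HPlus A →L[ℂ] HMinus A) (f : HPlus A) :
    imPart B f =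
      (1 / (2 * Complex.I) : ℂ) • (boundaryPart B f - boundaryPart (adj B) f) := by
  simp only [boundaryPart_apply, imPart, smul_apply, sub_apply, sub_sub_sub_cancel_right]

theorem IsStarExtension.imPart_apply_of_mem_domain (hB : IsStarExtension B T)
    (hA : Dense (A.domain : Set H)) {g : HPlus A} (hg : HPlus.incl A g ∈ T.domain) :
    imPart B g = Complex.I • boundaryPart (rePart B) g := by
  have hadj := LinearPMap.adjoint_isFormalAdjoint (hA.mono hB.le_T.1)
  rw [imPart_apply_eq_boundaryPart_sub, boundaryPart_rePart_apply,
    hB.extends_T.boundaryPart_apply_eq_zero hA hadj.symm hB.le_T_adjoint hg, zero_add, zero_sub,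
    one_div, mul_inv, Complex.inv_I]
  module

theorem IsStarExtension.imPart_apply_of_mem_adjoint_domain (hB : IsStarExtension B T)
    (hA : Dense (A.domain : Set H)) {g : HPlus A} (hg : HPlus.incl A g ∈ T†.domain) :
    imPart B g = (-Complex.I) • boundaryPart (rePart B) g := by
  have hadj := LinearPMap.adjoint_isFormalAdjoint (hA.mono hB.le_T.1)
  rw [imPart_apply_eq_boundaryPart_sub, boundaryPart_rePart_apply,
    hB.adj_extends_T_adjoint.boundaryPart_apply_eq_zero hA hadj hB.le_T hg, add_zero, sub_zero,
    one_div, mul_inv, Complex.inv_I]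
  module

theorem IsStarExtension.range_boundaryPart_rePart (hB : IsStarExtension B T)
    (hA : Dense (A.domain : Set H)) (hdom : A.domain = T.domain ⊓ T†.domain)
    [FiniteDimensional ℂ (imPart B).range] :
    (boundaryPart (rePart B)).range = (imPart B).range := by
  have hW := topologicalClosure_sup_comap_domain_eq_top hA hB.le_T hB.le_T_adjoint hdom
    hB.exists_regularPoint
  have hT := fun g hg => hB.imPart_apply_of_mem_domain hA (g := g) hg
  have hT' := fun g hg => hB.imPart_apply_of_mem_adjoint_domain hA (g := g) hg
  have hle : (boundaryPart (rePart B)).range ≤ (imPart B).range :=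
    range_le_range_of_eqOn_smul hW (a := -Complex.I) (b := Complex.I)
      (fun g hg => by rw [hT g hg, smul_smul]; simp) fun g hg => by rw [hT' g hg, smul_smul]; simp
  have : FiniteDimensional ℂ (boundaryPart (rePart B)).range :=
    Submodule.finiteDimensional_of_le hle
  exact hle.antisymm (range_le_range_of_eqOn_smul hW hT hT')

theorem re_rePart_apply_self (B : HPlus A →L[ℂ] HMinus A) (f : HPlus A) :
    (rePart B f f).re = (B f f).re := by
  rw [rePart, smul_apply, smul_apply, add_apply, add_apply, adj_apply, Complex.add_conj]
  simp

theorem isAccretive_rePart_iff : IsAccretive (rePart B) ↔ IsAccretive B := by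
  simp only [IsAccretive, re_rePart_apply_self]

end StarExtension

end RiggedSystem

/-- A set of non-real points that is dense in `ℂ \ ℝ` and contains no two conjugate points, so
that the kernel of an operator function is defined on it. -/
def conjFreeSet : Set ℂ :=
  {z | (0 < z.im ∧ ¬Irrational z.re) ∨ (z.im < 0 ∧ Irrational z.re)}

theorem im_ne_zero_of_mem_conjFreeSet {z : ℂ} (hz : z ∈ conjFreeSet) : z.im ≠ 0 := by
  rcases hz with ⟨him, -⟩ | ⟨him, -⟩
  exacts [him.ne', him.ne]

theorem ne_conj_of_mem_conjFreeSet {z w : ℂ} (hz : z ∈ conjFreeSet) (hw : w ∈ conjFreeSet) :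
    z ≠ conj w := by
  rintro rfl
  rcases hz with ⟨hz, hzr⟩ | ⟨hz, hzr⟩ <;> rcases hw with ⟨hw, hwr⟩ | ⟨hw, hwr⟩ <;>
    simp only [Complex.conj_im, Complex.conj_re] at hz hzr
  · linarith
  · exact hzr hwr
  · exact hwr hzr
  · linarith

theorem neg_I_notMem_conjFreeSet : -Complex.I ∉ conjFreeSet := by
  rintro (⟨him, -⟩ | ⟨-, hre⟩)
  · norm_num at him
  · rw [Complex.neg_re, Complex.I_re, neg_zero] at hre
    exact not_irrational_zero hre

theorem mem_closure_of_dense_re {Z : Set ℂ} {S : Set ℝ} (hS : Dense S) {w : ℂ}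
    (h : ∀ x ∈ S, (⟨x, w.im⟩ : ℂ) ∈ Z) : w ∈ closure Z := by
  have hcont : Continuous fun x : ℝ => (⟨x, w.im⟩ : ℂ) :=
    Complex.equivRealProdCLM.symm.continuous.comp (by fun_prop : Continuous fun x : ℝ => (x, w.im))
  exact map_mem_closure hcont (hS w.re) h

theorem mem_closure_conjFreeSet {w : ℂ} (hw : w.im ≠ 0) : w ∈ closure conjFreeSet := by
  rcases lt_or_gt_of_ne hw with him | him
  · exact mem_closure_of_dense_re dense_irrational fun x hx => Or.inr ⟨him, hx⟩
  · refine mem_closure_of_dense_re Rat.denseRange_cast ?_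
    rintro _ ⟨q, rfl⟩
    exact Or.inl ⟨him, q.not_irrational⟩

namespace RiggedCanonicalSystem

variable {H E : Type*}
  [NormedAddCommGroup H] [InnerProductSpace ℂ H] [CompleteSpace H]
  [NormedAddCommGroup E] [InnerProductSpace ℂ E] [FiniteDimensional ℂ E]
  {Θ : RiggedCanonicalSystem H E}

section Definedness

theorem shifted_eq_shift (Θ : RiggedCanonicalSystem H E) (z : ℂ) :
    Θ.shifted z = shift (rePart Θ.main) z := rfl

theorem isSelfAdjointBiExtension_rePart (Θ : RiggedCanonicalSystem H E) :
    IsSelfAdjointBiExtension (rePart Θ.main) :=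
  Θ.isStarExtension.rePart_biExtension

theorem range_boundaryPart_rePart (Θ : RiggedCanonicalSystem H E) :
    (boundaryPart (rePart Θ.main)).range = (imPart Θ.main).range := by
  have hle : (imPart Θ.main).range ≤ Θ.K.range := by
    rw [Θ.imPart_main]
    rintro _ ⟨f, rfl⟩
    exact ⟨Θ.J (channelAdj Θ.K f), rfl⟩
  have : FiniteDimensional ℂ (imPart Θ.main).range := Submodule.finiteDimensional_of_le hle
  exact Θ.isStarExtension.range_boundaryPart_rePart Θ.dense_A Θ.domain_A

theorem isDefinedAt_of_isResolvent {z : ℂ} {r : H →L[ℂ] HPlus Θ.A}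
    (hr : IsResolvent (rePart Θ.main) z r) {c : ℝ} (hc : 0 < c)
    (hb : IsBoundedBelowAt (rePart Θ.main) z c)
    (hK : ∀ e : E, ∃ (f : HPlus Θ.A) (h : H), Θ.K e = imPart Θ.main f + HMinus.ofH Θ.A h) :
    Θ.IsDefinedAt z := by
  refine ⟨hb.shift_injective hc Θ.isSelfAdjointBiExtension_rePart Θ.dense_A, fun e => ?_⟩
  obtain ⟨f, h, hf⟩ := hK e
  obtain ⟨g, hg⟩ : imPart Θ.main f ∈ (boundaryPart (rePart Θ.main)).range := by
    rw [Θ.range_boundaryPart_rePart]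
    exact ⟨f, rfl⟩
  rw [hf, ← hg]
  exact hr.exists_shift_eq g h

theorem isDefinedAt_of_im_ne_zero
    (hK : ∀ e : E, ∃ (f : HPlus Θ.A) (h : H), Θ.K e = imPart Θ.main f + HMinus.ofH Θ.A h)
    {z : ℂ} (hz : z.im ≠ 0) : Θ.IsDefinedAt z := by
  have hB := Θ.isSelfAdjointBiExtension_rePart
  obtain ⟨r, hr⟩ := hB.exists_isResolvent_of_im_ne_zero Θ.dense_A hz
  exact isDefinedAt_of_isResolvent hr (abs_pos.2 hz) (hB.isBoundedBelowAt z) hK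

end Definedness

section Pairing

variable {z w : ℂ} {e e' : E} {u v : HPlus Θ.A}

theorem inner_V_apply (h : Θ.IsDefinedAt z) (hu : Θ.shifted z u = Θ.K e) (e' : E) :
    ⟪e', Θ.V z e⟫_ℂ = conj (Θ.K e' u) := by
  have hinv : Θ.invK h e = u := h.1 (by rw [Θ.shifted_invK h e, hu])
  have hV : Θ.V z e = channelAdj Θ.K (Θ.invK h e) := by
    rw [V, dif_pos h]
    rfl
  rw [hV, inner_channelAdj, hinv]

theorem inner_V_eq (h : Θ.IsDefinedAt z) (hu : Θ.shifted z u = Θ.K e)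
    (hv : Θ.shifted w v = Θ.K e') :
    ⟪e', Θ.V z e⟫_ℂ =
      rePart Θ.main u v - conj w * ⟪HPlus.incl Θ.A v, HPlus.incl Θ.A u⟫_ℂ := by
  rw [inner_V_apply h hu, ← hv, shifted_eq_shift, shift_apply, sub_apply, smul_apply,
    HMinus.ofH_apply, map_sub, Θ.isSelfAdjointBiExtension_rePart.conj_apply, smul_eq_mul, map_mul,
    inner_conj_symm]

theorem V_inner_eq (h : Θ.IsDefinedAt w) (hu : Θ.shifted z u = Θ.K e)
    (hv : Θ.shifted w v = Θ.K e') :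
    ⟪Θ.V w e', e⟫_ℂ = rePart Θ.main u v - z * ⟪HPlus.incl Θ.A v, HPlus.incl Θ.A u⟫_ℂ := by
  rw [← inner_conj_symm, inner_V_eq h hv hu, map_sub,
    Θ.isSelfAdjointBiExtension_rePart.conj_apply, map_mul, Complex.conj_conj, inner_conj_symm]

theorem rePart_apply_eq_div (hz : Θ.IsDefinedAt z) (hw : Θ.IsDefinedAt w) (hzw : z ≠ conj w)
    (hu : Θ.shifted z u = Θ.K e) (hv : Θ.shifted w v = Θ.K e') :
    rePart Θ.main u v =
      (z * ⟪e', Θ.V z e⟫_ℂ - conj w * ⟪Θ.V w e', e⟫_ℂ) / (z - conj w) := by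
  rw [eq_div_iff (sub_ne_zero.2 hzw), inner_V_eq hz hu hv, V_inner_eq hw hu hv]
  ring

theorem V_symm (hz : Θ.IsDefinedAt z) (hz' : Θ.IsDefinedAt (conj z)) (x y : E) :
    ⟪Θ.V z x, y⟫_ℂ = ⟪x, Θ.V (conj z) y⟫_ℂ := by
  obtain ⟨u, hu⟩ := hz.2 x
  obtain ⟨v, hv⟩ := hz'.2 y
  rw [V_inner_eq hz hv hu, inner_V_eq hz' hv hu]

theorem V_im_nonneg (h : Θ.IsDefinedAt z) (hz : 0 < z.im) (e : E) :
    0 ≤ (⟪e, Θ.V z e⟫_ℂ).im := by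
  obtain ⟨u, hu⟩ := h.2 e
  rw [inner_V_eq h hu hu, Complex.sub_im, Θ.isSelfAdjointBiExtension_rePart.apply_self_im,
    inner_self_eq_ofReal_norm_sq, Complex.im_mul_ofReal, Complex.conj_im]
  linarith [mul_nonneg hz.le (sq_nonneg ‖HPlus.incl Θ.A u‖)]

end Pairing

section AccretiveToStieltjes

variable {r : H →L[ℂ] HPlus Θ.A}

theorem inner_V_neg_one (h : Θ.IsDefinedAt (-1)) (e e' : E) :
    ⟪e', Θ.V (-1) e⟫_ℂ = shift (rePart Θ.main) (-1) (Θ.invK h e) (Θ.invK h e') := by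
  rw [inner_V_apply h (Θ.shifted_invK h e), ← Θ.shifted_invK h e', shifted_eq_shift,
    Θ.isSelfAdjointBiExtension_rePart.conj_shift_neg_one_apply]

theorem isPositive_V_neg_one (hacc : IsAccretive (rePart Θ.main)) (h : Θ.IsDefinedAt (-1)) :
    (Θ.V (-1)).IsPositive := by
  refine isPositive_of_inner_eq_ofReal (fun e => ?_) fun e =>
    hacc.re_shift_neg_one_nonneg (Θ.invK h e)
  rw [inner_V_neg_one h]
  exact (Complex.conj_eq_iff_re.1
    (Θ.isSelfAdjointBiExtension_rePart.conj_shift_neg_one_apply _ _)).symm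

/-- The operator `(Re 𝔸 + I)⁻¹ K` from `E` to `H`. -/
noncomputable def channelAtNegOne (h : Θ.IsDefinedAt (-1)) : E →L[ℂ] H :=
  (HPlus.inclL Θ.A).comp (LinearMap.toContinuousLinearMap (Θ.invK h))

theorem isFormDominated_channelAtNegOne (hacc : IsAccretive (rePart Θ.main))
    (hr : IsResolvent (rePart Θ.main) (-1) r) (h : Θ.IsDefinedAt (-1)) (e : E) :
    IsFormDominated ((HPlus.inclL Θ.A).comp r) (channelAtNegOne h e) (⟪e, Θ.V (-1) e⟫_ℂ).re := by
  have hB := Θ.isSelfAdjointBiExtension_rePart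
  intro k
  have hkC : ⟪k, ((HPlus.inclL Θ.A).comp r) k⟫_ℂ = shift (rePart Θ.main) (-1) (r k) (r k) := by
    rw [← inner_conj_symm, ← hB.conj_shift_neg_one_apply, ← hr.inner_incl]
    rfl
  have hkF : ⟪channelAtNegOne h e, k⟫_ℂ = shift (rePart Θ.main) (-1) (r k) (Θ.invK h e) :=
    hr.inner_incl k _
  rw [hkC, inner_V_neg_one h, ← inner_conj_symm, RCLike.norm_conj, hkF]
  exact hacc.norm_shift_neg_one_sq_le hB _ _

theorem inverse_one_sub_smul_channelAtNegOne (hr : IsResolvent (rePart Θ.main) (-1) r)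
    (h : Θ.IsDefinedAt (-1)) {z : ℂ} (hz : z.im ≠ 0) {e : E} {v : HPlus Θ.A}
    (hv : Θ.shifted z v = Θ.K e) :
    Ring.inverse (1 - (z + 1) • (HPlus.inclL Θ.A).comp r) (channelAtNegOne h e) =
      HPlus.incl Θ.A v := by
  have hunit : IsUnit (1 - (z + 1) • (HPlus.inclL Θ.A).comp r) :=
    isUnit_one_sub_smul (hr.isSelfAdjoint_neg_one Θ.isSelfAdjointBiExtension_rePart)
      (by simpa using hz)
  have hres := hr.eq_add_smul h.1 ((Θ.shifted_invK h e).trans hv.symm)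
  rw [sub_neg_eq_add] at hres
  have happly : (1 - (z + 1) • (HPlus.inclL Θ.A).comp r) (HPlus.incl Θ.A v) =
      channelAtNegOne h e :=
    sub_eq_iff_eq_add.2 (congrArg (HPlus.incl Θ.A) hres)
  rw [← happly]
  exact congrArg (fun L : H →L[ℂ] H => L (HPlus.incl Θ.A v)) (Ring.inverse_mul_cancel _ hunit)

theorem V_eq_transferFunction [CompleteSpace E] (hr : IsResolvent (rePart Θ.main) (-1) r)
    (h : Θ.IsDefinedAt (-1)) {z : ℂ} (hz : z.im ≠ 0) (hdef : Θ.IsDefinedAt z) :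
    Θ.V z = transferFunction ((HPlus.inclL Θ.A).comp r) (channelAtNegOne h) (Θ.V (-1)) z := by
  have hB := Θ.isSelfAdjointBiExtension_rePart
  refine ContinuousLinearMap.ext fun e => ext_inner_left ℂ fun e' => ?_
  obtain ⟨v, hv⟩ := hdef.2 e
  have hres := hr.eq_add_smul h.1 ((Θ.shifted_invK h e).trans hv.symm)
  rw [sub_neg_eq_add] at hres
  have hadj : ⟪e', ContinuousLinearMap.adjoint (channelAtNegOne h) (HPlus.incl Θ.A v)⟫_ℂ =
      shift (rePart Θ.main) (-1) (r (HPlus.incl Θ.A v)) (Θ.invK h e') := by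
    rw [ContinuousLinearMap.adjoint_inner_right]
    exact hr.inner_incl _ _
  calc ⟪e', Θ.V z e⟫_ℂ = shift (rePart Θ.main) (-1) v (Θ.invK h e') := by
        rw [inner_V_apply hdef hv, ← Θ.shifted_invK h e', shifted_eq_shift,
          hB.conj_shift_neg_one_apply]
    _ = ⟪e', Θ.V (-1) e⟫_ℂ + (z + 1) *
        ⟪e', ContinuousLinearMap.adjoint (channelAtNegOne h) (HPlus.incl Θ.A v)⟫_ℂ := by
      rw [hadj, inner_V_neg_one h]
      conv_lhs => rw [hres]
      rw [map_add, map_smul, add_apply, smul_apply, smul_eq_mul]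
    _ = _ := by
      rw [← inverse_one_sub_smul_channelAtNegOne hr h hz hv, ← inner_smul_right,
        ← inner_add_right]
      rfl

theorem isStieltjes_V_of_isAccretive
    (hK : ∀ e : E, ∃ (f : HPlus Θ.A) (h : H), Θ.K e = imPart Θ.main f + HMinus.ofH Θ.A h)
    (hacc : IsAccretive (rePart Θ.main)) : IsStieltjes Θ.V := by
  have : CompleteSpace E := FiniteDimensional.complete ℂ E
  have hB := Θ.isSelfAdjointBiExtension_rePart
  obtain ⟨r, hr⟩ := hacc.exists_isResolvent_neg_one hB Θ.dense_A
  have hC := hr.isSelfAdjoint_neg_one hB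
  have hdef : ∀ z : ℂ, z.im ≠ 0 → Θ.IsDefinedAt z := fun z hz => isDefinedAt_of_im_ne_zero hK hz
  have hdef₁ : Θ.IsDefinedAt (-1) :=
    isDefinedAt_of_isResolvent hr one_pos hacc.isBoundedBelowAt_neg_one hK
  have hV : ∀ z : ℂ, z.im ≠ 0 → Θ.V z =
      transferFunction ((HPlus.inclL Θ.A).comp r) (channelAtNegOne hdef₁) (Θ.V (-1)) z :=
    fun z hz => V_eq_transferFunction hr hdef₁ hz (hdef z hz)
  have hdiff : DifferentiableOn ℂ Θ.V {z | z.im ≠ 0} :=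
    DifferentiableOn.congr
      (fun z hz => (differentiableAt_transferFunction hC hz).differentiableWithinAt) hV
  obtain ⟨γ, G, hG, hγ, hint, hrep⟩ := exists_stieltjes_representation_transferFunction hC
    (hr.spectrum_subset_Icc hB hacc) (isPositive_V_neg_one hacc hdef₁)
    (isFormDominated_channelAtNegOne hacc hr hdef₁)
  exact ⟨⟨hdiff, fun z hz => V_symm (hdef z hz) (hdef _ (by simpa using hz)),
    fun z hz => V_im_nonneg (hdef z hz.ne') hz⟩, γ, G, hG, hγ, hint,
    fun z hz e => by rw [hV z hz, hrep z hz e]⟩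

end AccretiveToStieltjes

section KernelToAccretive

theorem exists_shifted_eq_of_mem_defect {z : ℂ} {f : HPlus Θ.A} (hf : f ∈ HPlus.defect Θ.A z) :
    ∃ e, Θ.shifted z f = Θ.K e := by
  obtain ⟨g, hg⟩ : boundaryPart (rePart Θ.main) f ∈ (imPart Θ.main).range := by
    rw [← Θ.range_boundaryPart_rePart]
    exact ⟨f, rfl⟩
  refine ⟨Θ.J (channelAdj Θ.K g), ?_⟩
  rw [shifted_eq_shift, shift_eq_boundaryPart_add, HPlus.mem_defect.1 hf, sub_self, map_zero,
    add_zero, ← hg, Θ.imPart_main]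
  rfl

theorem re_rePart_nonneg_of_mem_defectSpan (hdef : ∀ z : ℂ, z.im ≠ 0 → Θ.IsDefinedAt z)
    (hV : KernelNonneg Θ.V) {f : HPlus Θ.A} (hf : f ∈ defectSpan Θ.A conjFreeSet) :
    0 ≤ (rePart Θ.main f f).re := by
  obtain ⟨n, c, g, rfl⟩ := Submodule.mem_span_set'.1 hf
  choose z hzZ hz using fun i => (g i).2
  choose e he using fun i =>
    exists_shifted_eq_of_mem_defect (Submodule.smul_mem _ (c i) (hz i))
  have him := fun i => im_ne_zero_of_mem_conjFreeSet (hzZ i)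
  have hne := fun k l => ne_conj_of_mem_conjFreeSet (hzZ k) (hzZ l)
  have hkernel := fun k l =>
    rePart_apply_eq_div (hdef _ (him k)) (hdef _ (him l)) (hne k l) (he k) (he l)
  have hnonneg := hV n z e him hne
  rw [Finset.sum_comm] at hnonneg
  simpa only [map_sum, sum_apply, hkernel] using hnonneg

theorem isAccretive_rePart_of_kernelNonneg (hprime : Θ.IsPrime)
    (hdef : ∀ z : ℂ, z.im ≠ 0 → Θ.IsDefinedAt z) (hV : KernelNonneg Θ.V) :
    IsAccretive (rePart Θ.main) := by
  have htop : (defectSpan Θ.A conjFreeSet).topologicalClosure = ⊤ :=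
    Θ.isSelfAdjointBiExtension_rePart.topologicalClosure_defectSpan_eq_top Θ.dense_A
      (ζ := -Complex.I) (by simp) neg_I_notMem_conjFreeSet
      (fun _ => im_ne_zero_of_mem_conjFreeSet) (fun _ => mem_closure_conjFreeSet)
      (fun _ hz => hz.1) hprime
  have hcont : Continuous fun f : HPlus Θ.A => rePart Θ.main f f :=
    (rePart Θ.main).flip.continuous.clm_apply continuous_id
  have hclosed : IsClosed {f : HPlus Θ.A | 0 ≤ (rePart Θ.main f f).re} :=
    isClosed_le continuous_const (Complex.continuous_re.comp hcont)
  exact fun f => closure_minimal (fun g hg => re_rePart_nonneg_of_mem_defectSpan hdef hV hg)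
    hclosed (Submodule.dense_iff_topologicalClosure_eq_top.2 htop f)

end KernelToAccretive

end RiggedCanonicalSystem

theorem theorem4p2 {H E : Type*}
    [NormedAddCommGroup H] [InnerProductSpace ℂ H] [CompleteSpace H]
    [NormedAddCommGroup E] [InnerProductSpace ℂ E] [FiniteDimensional ℂ E]
    (Θ : RiggedCanonicalSystem H E) (hprime : Θ.IsPrime)
    (hK : ∀ e : E, ∃ (f : RiggedSystem.HPlus Θ.A) (h : H),
      Θ.K e = RiggedSystem.imPart Θ.main f + RiggedSystem.HMinus.ofH Θ.A h) :
    (∀ z : ℂ, z.im ≠ 0 → Θ.IsDefinedAt z) ∧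
      (IsStieltjes Θ.V ↔ RiggedSystem.IsAccretive Θ.main) := by
  have hdef : ∀ z : ℂ, z.im ≠ 0 → Θ.IsDefinedAt z := fun z hz =>
    RiggedCanonicalSystem.isDefinedAt_of_im_ne_zero hK hz
  refine ⟨hdef, fun hV => ?_, fun hacc => ?_⟩
  · exact isAccretive_rePart_iff.1
      (RiggedCanonicalSystem.isAccretive_rePart_of_kernelNonneg hprime hdef hV.kernelNonneg)
  · exact RiggedCanonicalSystem.isStieltjes_V_of_isAccretive hK (isAccretive_rePart_iff.2 hacc)
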